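/- Let $Q$ be a finite quiver with vertex set $V$, edge set $E$ and source and target maps $s,t\colon E\to V$. Its genus is the first Betti number of its geometric realization. A directed forest is a quiver of genus $0$, and a connected directed tree is a connected quiver of genus $0$. A multipath of $Q$ is a spanning subquiver each of whose connected components is a single vertex or a simple directed path, and the multipath complex $X(Q)$ is the simplicial complex on $E$ whose simplices are the edge sets of the multipaths with at least one edge. The matching complex $M(G)$ of an undirected graph $G$ is the simplicial complex on its edges whose simplices are the nonempty sets of pairwise disjoint edges. A vertex is unstable in a quiver if it is both the source of an edge and the target of an edge, and stable otherwise. For a subquiver $R$ of $Q$, let $C(R)$ be the subquiver spanned by the edges that are not in $R$, and let $\partial R=V(R)\cap V(C(R))$ be the boundary of $R$. A dynamical region of $Q$ is a connected subquiver $R$ with at least one edge such that (a) every vertex of $\partial R$ is unstable in $Q$ but stable in $R$ and in $C(R)$, and (b) every oriented cycle of $Q$ that contains an edge of $R$ is contained in $R$. It is stable if every vertex of $V(R)\setminus\partial R$ is stable in $Q$. A dynamical module is a dynamical region none of whose proper subquivers is a dynamical region. (1) Let $T$ be a finite connected directed tree. Every dynamical module of $T$ is stable, its underlying undirected graph is a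 tree, and (the geometric realization of) $X(T)$ is homotopy equivalent to the join of the matching complexes $M(\iota(D))$ of the underlying undirected trees $\iota(D)$, where $D$ ranges over the dynamical modules of $T$. (If $T$ has no edges, both sides are empty.) In particular, $X(T)$ is homotopy equivalent to a join of matching complexes of undirected trees. (2) Let $F$ be a finite directed forest. If $F$ has at least one edge, then $X(F)$ is contractible or homotopy equivalent to a wedge of finitely many spheres, possibly of different dimensions, where $0$-dimensional spheres are allowed. If $F$ has no edges, then $X(F)$ is empty. -/

import Mathlib

noncomputable section

namespace Multipath

/-! ### Quivers and subquivers -/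

/-- A quiver with vertex set `V` and edge set `E`: source and target functions `s, t : E → V`. -/
structure DirQuiver (V E : Type*) where
  s : E → V
  t : E → V

/-- A subquiver: a set of vertices and a set of edges containing all endpoints of the edges. -/
@[ext]
structure Subquiver {V E : Type*} (Q : DirQuiver V E) where
  verts : Set V
  edges : Set E
  s_mem : ∀ e ∈ edges, Q.s e ∈ verts
  t_mem : ∀ e ∈ edges, Q.t e ∈ verts

namespace Subquiver

variable {V E : Type*} {Q : DirQuiver V E}

/-- `H ≤ K` means that `H` is a subquiver of `K`. -/
instance : PartialOrder (Subquiver Q) :=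
  PartialOrder.lift (fun H => (H.verts, H.edges)) (by
    intro H K h
    simp only [Prod.mk.injEq] at h
    exact Subquiver.ext h.1 h.2)

theorem le_iff {H K : Subquiver Q} : H ≤ K ↔ H.verts ⊆ K.verts ∧ H.edges ⊆ K.edges := Iff.rfl

/-- `u` is joined to `v` by an edge of `H` with source `u` and target `v`. -/
def Step (H : Subquiver Q) (u v : V) : Prop := ∃ e ∈ H.edges, Q.s e = u ∧ Q.t e = v

/-- A subquiver is connected if it has a vertex and any two of its vertices are joined by an
unoriented path of edges. -/
def Connected (H : Subquiver Q) : Prop :=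
  H.verts.Nonempty ∧ ∀ u ∈ H.verts, ∀ v ∈ H.verts, Relation.EqvGen H.Step u v

/-- A connected component of `H`: a maximal connected subquiver of `H`. -/
def IsComponent (H C : Subquiver Q) : Prop :=
  Maximal (fun D => D ≤ H ∧ D.Connected) C

/-- A subquiver consisting of a single vertex. -/
def IsVertex (H : Subquiver Q) : Prop := (∃ v, H.verts = {v}) ∧ H.edges = ∅

/-- The edges of `H` are `e 0, …, e n`, its vertices are their endpoints, consecutive edges
are composable, and no two edges have the same source or the same target. -/
def IsTraversedBy (H : Subquiver Q) (n : ℕ) (e : Fin (n + 1) → E) : Prop :=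
  H.edges = Set.range e ∧
  H.verts = Q.s '' H.edges ∪ Q.t '' H.edges ∧
  (∀ i : Fin n, Q.s (e i.succ) = Q.t (e i.castSucc)) ∧
  (∀ i j, Q.s (e i) = Q.s (e j) ∨ Q.t (e i) = Q.t (e j) → i = j)

/-- A simple (directed) path, with at least one edge. -/
def IsSimplePath (H : Subquiver Q) : Prop :=
  ∃ (n : ℕ) (e : Fin (n + 1) → E), H.IsTraversedBy n e ∧ Q.s (e 0) ≠ Q.t (e (Fin.last n))

/-- An oriented cycle. -/
def IsOrientedCycle (H : Subquiver Q) : Prop :=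
  ∃ (n : ℕ) (e : Fin (n + 1) → E), H.IsTraversedBy n e ∧ Q.s (e 0) = Q.t (e (Fin.last n))

/-- A vertex is stable in `H` if it is not both the source of an edge of `H` and the target of an
edge of `H`. -/
def StableVertex (H : Subquiver Q) (v : V) : Prop := ¬ (v ∈ Q.s '' H.edges ∧ v ∈ Q.t '' H.edges)

/-- The complement of `H` in `Q`: the subquiver spanned by the edges that are not in `H`. -/
def compl (H : Subquiver Q) : Subquiver Q where
  verts := Q.s '' H.edgesᶜ ∪ Q.t '' H.edgesᶜ
  edges := H.edgesᶜ
  s_mem e he := Or.inl ⟨e, he, rfl⟩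
  t_mem e he := Or.inr ⟨e, he, rfl⟩

/-- The boundary of `H` in `Q`. -/
def boundary (H : Subquiver Q) : Set V := H.verts ∩ H.compl.verts

/-- The underlying undirected graph (without loops and multiple edges) of a subquiver. -/
def underlyingGraph (H : Subquiver Q) : SimpleGraph H.verts where
  Adj u v := u ≠ v ∧ (H.Step u v ∨ H.Step v u)
  symm := ⟨fun _ _ h => ⟨h.1.symm, h.2.symm⟩⟩
  loopless := ⟨fun _ h => h.1 rfl⟩

end Subquiver

namespace DirQuiver

variable {V E : Type*} (Q : DirQuiver V E)

/-- The spanning subquiver with a given set of edges. -/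
def spanning (σ : Set E) : Subquiver Q where
  verts := Set.univ
  edges := σ
  s_mem _ _ := trivial
  t_mem _ _ := trivial

/-- `Q`, as a subquiver of itself. -/
def whole : Subquiver Q := Q.spanning Set.univ

/-! ### Trees and forests -/

/-- The boundary map of the cellular chain complex (with rational coefficients) of the
1-dimensional CW complex with 0-cells the vertices and 1-cells the edges of `Q`. -/
def cellularBoundary : (E →₀ ℚ) →ₗ[ℚ] (V →₀ ℚ) :=
  Finsupp.linearCombination ℚ
    (fun e => Finsupp.single (Q.t e) (1 : ℚ) - Finsupp.single (Q.s e) (1 : ℚ))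

/-- The genus: the first Betti number of the geometric realization of `Q`. As the realization has
no cells of dimension above one, its first homology is the kernel of the boundary map. -/
def genus : ℕ := Module.finrank ℚ (LinearMap.ker Q.cellularBoundary)

/-- A (finite) directed forest: a quiver of genus zero. -/
def IsForest : Prop := Q.genus = 0

/-- A (finite) connected directed tree. -/
def IsTree : Prop := Q.whole.Connected ∧ Q.genus = 0

/-! ### Dynamical regions and modules -/

/-- Dynamical regions of `Q`. -/
def IsDynamicalRegion (R : Subquiver Q) : Prop :=
  R.Connected ∧ R.edges.Nonempty ∧
  (∀ v ∈ R.boundary, ¬ Q.whole.StableVertex v ∧ R.StableVertex v ∧ R.compl.StableVertex v) ∧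
  (∀ C : Subquiver Q, C.IsOrientedCycle → (C.edges ∩ R.edges).Nonempty → C ≤ R)

/-- A dynamical module: a dynamical region none of whose proper subquivers is a dynamical
region. -/
def IsDynamicalModule (M : Subquiver Q) : Prop := Minimal Q.IsDynamicalRegion M

/-- A dynamical region is stable if all its non-boundary vertices are stable. -/
def IsStableRegion (R : Subquiver Q) : Prop :=
  ∀ v ∈ R.verts \ R.boundary, Q.whole.StableVertex v

/-! ### Multipaths -/

/-- A multipath: a spanning subquiver each of whose connected components is a vertex or a simple
path. -/
def IsMultipath (H : Subquiver Q) : Prop :=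
  H.verts = Set.univ ∧ ∀ C, H.IsComponent C → C.IsVertex ∨ C.IsSimplePath

end DirQuiver

namespace Subquiver

variable {V E : Type*} {Q : DirQuiver V E}

theorem eqvGen_step_mono {H K : Subquiver Q} (h : H.edges ⊆ K.edges) {u v : V}
    (huv : Relation.EqvGen H.Step u v) : Relation.EqvGen K.Step u v :=
  Relation.EqvGen.mono (r := H.Step) (p := K.Step) (fun _ _ ⟨e, he, h'⟩ => ⟨e, h he, h'⟩) _ _ huv

/-- A connected subquiver of a subquiver lies in a connected component. -/
theorem exists_component {H C : Subquiver Q} (hC : C ≤ H) (hc : C.Connected) :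
    ∃ D, H.IsComponent D ∧ C ≤ D := by
  obtain ⟨⟨v, hv⟩, hconn⟩ := hc
  let D : Subquiver Q :=
    { verts := {w | w ∈ H.verts ∧ Relation.EqvGen H.Step v w}
      edges := {e | e ∈ H.edges ∧ Relation.EqvGen H.Step v (Q.s e)}
      s_mem := fun e he => ⟨H.s_mem e he.1, he.2⟩
      t_mem := fun e he => ⟨H.t_mem e he.1, he.2.trans _ _ _ (.rel _ _ ⟨e, he.1, rfl, rfl⟩)⟩ }
  have key : ∀ a b, Relation.EqvGen H.Step a b → Relation.EqvGen H.Step v a →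
      Relation.EqvGen D.Step a b := by
    intro a b hab
    induction hab with
    | rel x y h =>
      intro hx
      obtain ⟨e, he, rfl, rfl⟩ := h
      exact .rel _ _ ⟨e, ⟨he, hx⟩, rfl, rfl⟩
    | refl x => intro _; exact .refl _
    | symm x y h ih => intro hy; exact (ih (hy.trans _ _ _ (h.symm))).symm
    | trans x y z h1 h2 ih1 ih2 =>
      intro hx
      exact (ih1 hx).trans _ _ _ (ih2 (hx.trans _ _ _ h1))
  have hvH : v ∈ H.verts := hC.1 hv
  refine ⟨D, ⟨⟨⟨fun w hw => hw.1, fun e he => he.1⟩, ⟨v, hvH, .refl _⟩, ?_⟩, ?_⟩, ?_, ?_⟩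
  · intro a ha b hb
    exact key a b (ha.2.symm.trans _ _ _ hb.2) ha.2
  · rintro D' ⟨hD'H, hD'c⟩ hDD'
    have hvD' : v ∈ D'.verts := hDD'.1 ⟨hvH, .refl _⟩
    refine ⟨fun w hw => ⟨hD'H.1 hw, eqvGen_step_mono hD'H.2 (hD'c.2 v hvD' w hw)⟩,
      fun e he => ⟨hD'H.2 he, eqvGen_step_mono hD'H.2 (hD'c.2 v hvD' _ (D'.s_mem e he))⟩⟩
  · exact fun w hw => ⟨hC.1 hw, eqvGen_step_mono hC.2 (hconn v hv w hw)⟩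
  · exact fun e he => ⟨hC.2 he, eqvGen_step_mono hC.2 (hconn v hv _ (C.s_mem e he))⟩

theorem isVertex_of_edges_eq_empty {C : Subquiver Q} (hc : C.Connected) (he : C.edges = ∅) :
    C.IsVertex := by
  obtain ⟨⟨v, hv⟩, hconn⟩ := hc
  refine ⟨⟨v, Set.eq_singleton_iff_unique_mem.2 ⟨hv, fun w hw => ?_⟩⟩, he⟩
  have : ∀ a b, Relation.EqvGen C.Step a b → a = b := by
    intro a b h
    induction h with
    | rel x y h => obtain ⟨e, h', -⟩ := h; simp [he] at h'
    | refl x => rfl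
    | symm x y h ih => exact ih.symm
    | trans x y z h1 h2 ih1 ih2 => exact ih1.trans ih2
  exact this _ _ (hconn w hw v hv)

/-- A connected subquiver with an edge of a simple path is a simple path. -/
theorem IsSimplePath.of_le {C D : Subquiver Q} (hD : D.IsSimplePath) (hCD : C ≤ D)
    (hc : C.Connected) (hne : C.edges.Nonempty) : C.IsSimplePath := by
  classical
  obtain ⟨n, e, ⟨hE, -, hcomp, hinj⟩, hends⟩ := hD
  have hst : ∀ i j : Fin (n + 1), Q.s (e i) = Q.t (e j) → (i : ℕ) = j + 1 := by
    intro i j hij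
    rcases Fin.eq_castSucc_or_eq_last j with ⟨j', rfl⟩ | rfl
    · have := hinj i j'.succ (.inl (hij.trans (hcomp j').symm))
      simp [this]
    · rcases Fin.eq_zero_or_eq_succ i with rfl | ⟨i', rfl⟩
      · exact absurd hij hends
      · have := hinj i'.castSucc (Fin.last n) (.inr ((hcomp i').symm.trans hij))
        exact absurd this (Fin.castSucc_lt_last i').ne
  have hss : ∀ i j : Fin (n + 1), Q.s (e i) = Q.s (e j) → i = j := fun i j h => hinj i j (.inl h)
  have htt : ∀ i j : Fin (n + 1), Q.t (e i) = Q.t (e j) → i = j := fun i j h => hinj i j (.inr h)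
  have hidx : ∀ f ∈ C.edges, ∃ i, e i = f := fun f hf => by
    have h : f ∈ D.edges := hCD.2 hf
    rw [hE] at h
    exact h
  have hcont : ∀ i j k : Fin (n + 1), e i ∈ C.edges → e k ∈ C.edges → i ≤ j → j ≤ k →
      e j ∈ C.edges := by
    intro i j k hi hk hij hjk
    by_contra hj
    have hij' : i < j := lt_of_le_of_ne hij (by rintro rfl; exact hj hi)
    have hjk' : j < k := lt_of_le_of_ne hjk (by rintro rfl; exact hj hk)
    let P : V → Prop := fun v => ∃ m : Fin (n + 1), m < j ∧ (v = Q.s (e m) ∨ v = Q.t (e m))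
    have hP : ∀ m, e m ∈ C.edges → j < m → ¬ P (Q.s (e m)) ∧ ¬ P (Q.t (e m)) := by
      intro m _ hm
      constructor
      · rintro ⟨m', hm', h | h⟩
        · have := hss _ _ h
          omega
        · have := hst _ _ h
          omega
      · rintro ⟨m', hm', h | h⟩
        · have := hst _ _ h.symm
          omega
        · have := htt _ _ h
          omega
    have hinv : ∀ a b, Relation.EqvGen C.Step a b → (P a ↔ P b) := by
      intro a b hab
      induction hab with
      | rel x y h =>
        obtain ⟨f, hf, rfl, rfl⟩ := h
        obtain ⟨m, rfl⟩ := hidx f hf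
        rcases lt_trichotomy m j with hm | rfl | hm
        · exact ⟨fun _ => ⟨m, hm, .inr rfl⟩, fun _ => ⟨m, hm, .inl rfl⟩⟩
        · exact absurd hf hj
        · exact iff_of_false (hP m hf hm).1 (hP m hf hm).2
      | refl x => exact Iff.rfl
      | symm x y h ih => exact ih.symm
      | trans x y z h1 h2 ih1 ih2 => exact ih1.trans ih2
    exact (hP k hk hjk').1
      ((hinv _ _ (hc.2 _ (C.s_mem _ hi) _ (C.s_mem _ hk))).1 ⟨i, hij', .inl rfl⟩)
  let I : Finset (Fin (n + 1)) := Finset.univ.filter (fun i => e i ∈ C.edges)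
  have hI : I.Nonempty := by
    obtain ⟨f, hf⟩ := hne
    obtain ⟨i, rfl⟩ := hidx f hf
    exact ⟨i, by simpa [I] using hf⟩
  obtain ⟨a, ha, hmin⟩ := I.exists_min_image id hI
  obtain ⟨b, hb, hmax⟩ := I.exists_max_image id hI
  simp only [I, Finset.mem_filter, Finset.mem_univ, true_and, id] at ha hb hmin hmax
  have hab : a ≤ b := hmin b hb
  have hab' : (a : ℕ) ≤ b := hab
  have hbn := b.isLt
  let g : Fin ((b : ℕ) - a + 1) → E := fun i => e ⟨a + i, by omega⟩
  refine ⟨(b : ℕ) - a, g, ⟨?_, ?_, ?_, ?_⟩, ?_⟩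
  · ext f
    constructor
    · intro hf
      obtain ⟨i, rfl⟩ := hidx f hf
      have h1 : (a : ℕ) ≤ i := hmin i hf
      have h2 : (i : ℕ) ≤ b := hmax i hf
      exact ⟨⟨i - a, by omega⟩, congrArg e (Fin.ext (by simp; omega))⟩
    · rintro ⟨i, rfl⟩
      exact hcont a _ b ha hb (Fin.le_def.2 (by simp)) (Fin.le_def.2 (by simp; omega))
  · have hends' : ∀ u v, Relation.EqvGen C.Step u v → u = v ∨
        (u ∈ Q.s '' C.edges ∪ Q.t '' C.edges ∧ v ∈ Q.s '' C.edges ∪ Q.t '' C.edges) := by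
      intro u v huv
      induction huv with
      | rel x y h =>
        obtain ⟨f, hf, rfl, rfl⟩ := h
        exact .inr ⟨.inl ⟨f, hf, rfl⟩, .inr ⟨f, hf, rfl⟩⟩
      | refl x => exact .inl rfl
      | symm x y h ih => exact ih.imp Eq.symm And.symm
      | trans x y z h1 h2 ih1 ih2 =>
        rcases ih1 with rfl | h
        · exact ih2
        · rcases ih2 with rfl | h'
          · exact .inr h
          · exact .inr ⟨h.1, h'.2⟩
    ext v
    constructor
    · intro hv
      rcases hends' _ _ (hc.2 v hv _ (C.s_mem _ ha)) with h | h
      · exact .inl ⟨_, ha, h.symm⟩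
      · exact h.1
    · rintro (⟨f, hf, rfl⟩ | ⟨f, hf, rfl⟩)
      · exact C.s_mem f hf
      · exact C.t_mem f hf
  · intro i
    exact hcomp ⟨a + i, by omega⟩
  · intro i j hij
    have := congrArg Fin.val (hinj _ _ hij)
    exact Fin.ext (by simpa using this)
  · intro h
    have := hst _ _ h
    simp at this
    omega

end Subquiver

namespace DirQuiver

variable {V E : Type*} (Q : DirQuiver V E)

/-- Being a multipath is a monotone property. -/
theorem IsMultipath.mono {σ τ : Set E} (h : Q.IsMultipath (Q.spanning σ)) (hτ : τ ⊆ σ) :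
    Q.IsMultipath (Q.spanning τ) := by
  refine ⟨rfl, fun C hC => ?_⟩
  obtain ⟨⟨hCτ, hc⟩, -⟩ := hC
  rcases Set.eq_empty_or_nonempty C.edges with he | hne
  · exact .inl (Subquiver.isVertex_of_edges_eq_empty hc he)
  have hCσ : C ≤ Q.spanning σ := ⟨hCτ.1, hCτ.2.trans hτ⟩
  obtain ⟨D, hD, hCD⟩ := Subquiver.exists_component hCσ hc
  rcases h.2 D hD with hv | hp
  · obtain ⟨e, he⟩ := hne
    have := hCD.2 he
    simp [hv.2] at this
  · exact .inr (hp.of_le hCD hc hne)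

/-- The multipath complex of `Q`: the simplicial complex on the edges of `Q` whose simplices are
the (nonempty) edge sets of multipaths. -/
def multipathComplex : PreAbstractSimplicialComplex E where
  faces := {σ | σ.Nonempty ∧ Q.IsMultipath (Q.spanning (σ : Set E))}
  isRelLowerSet_faces := fun _ hσ =>
    ⟨hσ.1, fun _ hτσ hτ => ⟨hτ, hσ.2.mono Q (Finset.coe_subset.2 hτσ)⟩⟩

end DirQuiver

/-! ### Simplicial complexes -/

/-- The matching complex of an undirected graph: the simplicial complex on its edges whose
simplices are the (nonempty) sets of pairwise disjoint edges. -/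
def matchingComplex {W : Type*} (G : SimpleGraph W) : PreAbstractSimplicialComplex G.edgeSet where
  faces := {σ | σ.Nonempty ∧ ∀ e ∈ σ, ∀ f ∈ σ, e ≠ f → ∀ v, v ∈ e.1 → v ∉ f.1}
  isRelLowerSet_faces := fun _ hσ =>
    ⟨hσ.1, fun _ hτσ hτ => ⟨hτ, fun e he f hf => hσ.2 e (hτσ he) f (hτσ hf)⟩⟩

/-- The join of a family of simplicial complexes: the complex on the disjoint union of the vertex
sets whose simplices are the nonempty sets that meet each part in a simplex or not at all. -/
def join {ι : Type*} {α : ι → Type*} (K : ∀ i, PreAbstractSimplicialComplex (α i)) :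
    PreAbstractSimplicialComplex (Σ i, α i) where
  faces := {σ | σ.Nonempty ∧ ∀ i, (σ.preimage (Sigma.mk i) sigma_mk_injective.injOn).Nonempty →
    σ.preimage (Sigma.mk i) sigma_mk_injective.injOn ∈ (K i).faces}
  isRelLowerSet_faces := fun σ hσ => ⟨hσ.1, fun τ hτσ hτ => ⟨hτ, fun i hi => by
    have hsub : τ.preimage (Sigma.mk i) sigma_mk_injective.injOn ⊆
        σ.preimage (Sigma.mk i) sigma_mk_injective.injOn := by
      intro x hx
      rw [Finset.mem_preimage] at hx ⊢
      exact hτσ hx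
    exact ((K i).isRelLowerSet_faces (hσ.2 i (hi.mono hsub))).2 hsub hi⟩⟩

/-- The points of the geometric realization of a simplicial complex with finitely many vertices,
in barycentric coordinates. -/
def realization {α : Type*} (K : PreAbstractSimplicialComplex α) : Set (α → ℝ) :=
  {x | (∀ a, 0 ≤ x a) ∧ ∃ σ ∈ K.faces, (∀ a, a ∉ σ → x a = 0) ∧ ∑ a ∈ σ, x a = 1}

/-! ### Wedges of spheres -/

/-- The `d`-dimensional unit sphere. -/
abbrev Sphere (d : ℕ) : Type := Metric.sphere (0 : EuclideanSpace ℝ (Fin (d + 1))) 1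

/-- The base point `(1, 0, …, 0)` of the `d`-dimensional sphere. -/
def Sphere.base (d : ℕ) : Sphere d := ⟨EuclideanSpace.single 0 1, by simp⟩

/-- The equivalence relation on a disjoint union of spheres that identifies all base points. -/
def wedgeSetoid {ι : Type*} (d : ι → ℕ) : Setoid (Σ i, Sphere (d i)) where
  r x y := x = y ∨ (x.2 = Sphere.base _ ∧ y.2 = Sphere.base _)
  iseqv :=
    { refl := fun _ => .inl rfl
      symm := by
        rintro x y (h | h)
        · exact .inl h.symm
        · exact .inr ⟨h.2, h.1⟩
      trans := by
        rintro x y z (rfl | h) (rfl | h')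
        · exact .inl rfl
        · exact .inr h'
        · exact .inr h
        · exact .inr ⟨h.1, h'.2⟩ }

/-- The wedge of spheres of dimensions `d i`, with the quotient topology. -/
abbrev WedgeOfSpheres {ι : Type*} (d : ι → ℕ) : Type _ := Quotient (wedgeSetoid d)

end Multipath

end

/-!
A chain of composable edges of a forest `Q` never closes up, so a set of edges spans a multipath if
and only if no two of its edges are in conflict, that is, have the same source or the same target
(`DirQuiver.IsForest.isMultipath_iff`). In other words, the multipath complex of `Q` is the
matching complex of the quiver `Q.split` in which every vertex is split into an outgoing and an
incoming half. Forests enter through linear algebra: genus zero means that the cellular boundary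
map is injective. This makes every edge a bridge, it shows that the two halves of a vertex lie in
different components of `Q.split`, and that `Q.split` is a forest, too.

*The join.* A dynamical region of a forest contains with an edge all edges in conflict with it,
and the dynamical modules are the classes of the equivalence relation generated by conflict, that
is, the components of `Q.split` that have an edge. No vertex of a module is both a source and a
target in it, hence two edges of a module are in conflict if and only if they share a vertex. So
the multipath complex is even isomorphic to the join of the matching complexes of the modules
(`DirQuiver.IsForest.mem_multipathComplex_iff`).

*The wedge of spheres.* By a dimension count, every nonempty set of edges of `Q.split` has an edge
with an end on no other edge of the set; the edges in conflict with it are pairwise in conflict.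
So the conflict graph is chordal, and the multipath complex is its independence complex. By
induction over a simplicial vertex, the independence complex of a chordal graph becomes
collapsible when a suitable set of facets is removed (`exists_facets_collapsible`). Collapsible
complexes are contractible (`Collapsible.contractibleSpace`), and a complex which becomes
contractible when some facets are removed is homotopy equivalent to the wedge of the quotients of
these facets by their boundaries, which are spheres
(`IsFacetFamily.nonempty_homotopyEquiv_wedge`). This is proved by an explicit form of the homotopy
extension property: the points near the boundaries of the facets are first pushed into the
contractible part, and then follow its contraction.
-/

noncomputable section

namespace Multipath

/-! ### Forests -/

namespace DirQuiver

variable {V E : Type*} {Q : DirQuiver V E}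

theorem cellularBoundary_single (Q : DirQuiver V E) (e : E) :
    Q.cellularBoundary (Finsupp.single e 1) =
      Finsupp.single (Q.t e) 1 - Finsupp.single (Q.s e) 1 := by
  simp [cellularBoundary]

theorem IsForest.cellularBoundary_injective [Finite E] (h : Q.IsForest) :
    Function.Injective Q.cellularBoundary := by
  rw [← LinearMap.ker_eq_bot]
  exact Submodule.finrank_eq_zero.1 h

/-- Vertices joined by an unoriented path in `H` differ by the boundary of a chain on the edges
of `H`. -/
theorem exists_chain {H : Subquiver Q} {u v : V} (h : Relation.EqvGen H.Step u v) :
    ∃ c : E →₀ ℚ, (∀ e ∉ H.edges, c e = 0) ∧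
      Q.cellularBoundary c = Finsupp.single v 1 - Finsupp.single u 1 := by
  classical
  induction h with
  | rel x y h =>
    obtain ⟨e, he, rfl, rfl⟩ := h
    refine ⟨Finsupp.single e 1, fun f hf => ?_, Q.cellularBoundary_single e⟩
    rw [Finsupp.single_apply, if_neg]
    rintro rfl
    exact hf he
  | refl x => exact ⟨0, by simp, by simp⟩
  | symm x y h ih =>
    obtain ⟨c, hc, hb⟩ := ih
    exact ⟨-c, fun e he => by simp [hc e he], by simp [hb]⟩
  | trans x y z h1 h2 ih1 ih2 =>
    obtain ⟨c, hc, hb⟩ := ih1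
    obtain ⟨c', hc', hb'⟩ := ih2
    exact ⟨c + c', fun e he => by simp [hc e he, hc' e he], by simp [hb, hb']⟩

/-- Every edge of a forest is a bridge. -/
theorem IsForest.not_eqvGen_of_notMem [Finite E] (hQ : Q.IsForest) {H : Subquiver Q} {e : E}
    (he : e ∉ H.edges) : ¬ Relation.EqvGen H.Step (Q.s e) (Q.t e) := by
  intro h
  obtain ⟨c, hc, hb⟩ := exists_chain h
  have := hQ.cellularBoundary_injective (hb.trans (Q.cellularBoundary_single e).symm)
  have h0 := hc e he
  rw [this] at h0
  simp at h0

theorem IsForest.s_ne_t [Finite E] (hQ : Q.IsForest) (e : E) : Q.s e ≠ Q.t e := by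
  intro h
  refine hQ.not_eqvGen_of_notMem (H := Q.spanning ∅) (e := e) (by simp [spanning]) ?_
  rw [h]
  exact .refl _

/-- In a forest, an edge is determined by the set of its endpoints. -/
theorem IsForest.eq_of_sym2_eq [Finite E] (hQ : Q.IsForest) {e f : E}
    (h : s(Q.s e, Q.t e) = s(Q.s f, Q.t f)) : e = f := by
  by_contra hne
  refine hQ.not_eqvGen_of_notMem (H := Q.spanning {f}) (e := e) (by simpa [spanning] using hne) ?_
  have hf : Relation.EqvGen (Q.spanning {f}).Step (Q.s f) (Q.t f) := .rel _ _ ⟨f, rfl, rfl, rfl⟩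
  rcases Sym2.eq_iff.1 h with ⟨h1, h2⟩ | ⟨h1, h2⟩
  · rwa [h1, h2]
  · rw [h1, h2]
    exact hf.symm

/-- A chain of composable edges of a forest does not close up. -/
theorem IsForest.s_zero_ne_t_last [Finite E] (hQ : Q.IsForest) {n : ℕ} {e : Fin (n + 1) → E}
    (he : Function.Injective e) (hcomp : ∀ i : Fin n, Q.s (e i.succ) = Q.t (e i.castSucc)) :
    Q.s (e 0) ≠ Q.t (e (Fin.last n)) := by
  intro h
  refine hQ.not_eqvGen_of_notMem (H := Q.spanning {e 0}ᶜ) (e := e 0)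
    (fun h => h rfl) (Relation.EqvGen.symm _ _ ?_)
  rw [h]
  have key : ∀ i, Relation.EqvGen (Q.spanning {e 0}ᶜ).Step (Q.t (e 0)) (Q.t (e i)) := by
    intro i
    induction i using Fin.induction with
    | zero => exact .refl _
    | succ i ih =>
      refine ih.trans _ _ _ (.rel _ _ ⟨e i.succ, fun h => ?_, hcomp i, rfl⟩)
      exact Fin.succ_ne_zero i (he h)
  exact key _

theorem IsForest.not_isOrientedCycle [Finite E] (hQ : Q.IsForest) (C : Subquiver Q) :
    ¬ C.IsOrientedCycle := by
  rintro ⟨n, e, ⟨-, -, hcomp, hinj⟩, h⟩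
  exact hQ.s_zero_ne_t_last (fun i j hij => hinj i j (.inl (congrArg Q.s hij))) hcomp h

/-! ### Splitting the vertices of a quiver -/

/-- The quiver obtained by splitting every vertex `v` into `inl v`, which keeps the edges with
source `v`, and `inr v`, which keeps the edges with target `v`. -/
def split (Q : DirQuiver V E) : DirQuiver (V ⊕ V) E where
  s e := .inl (Q.s e)
  t e := .inr (Q.t e)

theorem mapDomain_cellularBoundary_split (Q : DirQuiver V E) (c : E →₀ ℚ) :
    Finsupp.mapDomain (Sum.elim id id) (Q.split.cellularBoundary c) = Q.cellularBoundary c := by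
  have : (Finsupp.lmapDomain ℚ ℚ (Sum.elim id id)).comp Q.split.cellularBoundary =
      Q.cellularBoundary := by
    ext e : 2
    simp [cellularBoundary, split, Finsupp.mapDomain_sub, Finsupp.mapDomain_single]
  exact LinearMap.congr_fun this c

theorem IsForest.split [Finite E] (hQ : Q.IsForest) : Q.split.IsForest := by
  refine Submodule.finrank_eq_zero.2 (LinearMap.ker_eq_bot.2 ?_)
  intro c c' h
  apply hQ.cellularBoundary_injective
  rw [← mapDomain_cellularBoundary_split, h, mapDomain_cellularBoundary_split]

/-- In a forest, the two halves of a vertex lie in different components of the split quiver. -/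
theorem IsForest.not_eqvGen_split [Finite E] (hQ : Q.IsForest) {H : Subquiver Q.split} (v : V) :
    ¬ Relation.EqvGen H.Step (.inl v) (.inr v) := by
  intro h
  obtain ⟨c, -, hb⟩ := exists_chain h
  have hc : c = 0 := by
    apply hQ.cellularBoundary_injective
    rw [← mapDomain_cellularBoundary_split, hb]
    simp [Finsupp.mapDomain_sub, Finsupp.mapDomain_single]
  have := DFunLike.congr_fun hb (.inr v)
  simp [hc] at this

/-! ### Conflicts between edges -/

/-- Two edges are in conflict if they have the same source or the same target. -/
def Conflict (Q : DirQuiver V E) (e f : E) : Prop := Q.s e = Q.s f ∨ Q.t e = Q.t f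

theorem Conflict.symm {e f : E} (h : Q.Conflict e f) : Q.Conflict f e := h.imp Eq.symm Eq.symm

/-- A nonempty set of edges of a forest contains an edge that has, in the split forest, an end on
no other edge of the set: counting dimensions, the edges are independent relations between the
vertices, so they are fewer than their ends. -/
theorem IsForest.exists_leaf [Finite E] (hQ : Q.IsForest) {A : Finset E} (hA : A.Nonempty) :
    ∃ e ∈ A, (∀ f ∈ A, Q.s f = Q.s e → f = e) ∨ (∀ f ∈ A, Q.t f = Q.t e → f = e) := by
  classical
  by_contra! hno
  obtain ⟨e₀, he₀⟩ := hA
  have hS : (A.image Q.s).card * 2 ≤ A.card := by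
    rw [mul_comm]
    refine Finset.mul_card_image_le_card _ 2 fun v hv => ?_
    obtain ⟨e, he, rfl⟩ := Finset.mem_image.1 hv
    obtain ⟨f, hf, hfe, hne⟩ := (hno e he).1
    exact Finset.one_lt_card.2 ⟨f, by simp [hf, hfe], e, by simp [he], hne⟩
  have hT : (A.image Q.t).card * 2 ≤ A.card := by
    rw [mul_comm]
    refine Finset.mul_card_image_le_card _ 2 fun v hv => ?_
    obtain ⟨e, he, rfl⟩ := Finset.mem_image.1 hv
    obtain ⟨f, hf, hfe, hne⟩ := (hno e he).2
    exact Finset.one_lt_card.2 ⟨f, by simp [hf, hfe], e, by simp [he], hne⟩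
  let b : A → (V ⊕ V →₀ ℚ) := fun e =>
    Finsupp.single (Q.split.t e) 1 - Finsupp.single (Q.split.s e) 1
  have hb : LinearIndependent ℚ b :=
    LinearIndependent.comp (v := fun e : E =>
      (Finsupp.single (Q.split.t e) 1 - Finsupp.single (Q.split.s e) 1 : V ⊕ V →₀ ℚ))
      hQ.split.cellularBoundary_injective _ Subtype.val_injective
  -- The sum of the coefficients vanishes on the boundary of every edge, but not on a vertex.
  have hnone : (Finsupp.single (Q.split.s e₀) 1 : V ⊕ V →₀ ℚ) ∉ Submodule.span ℚ (Set.range b) := by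
    let sumCoeff : (V ⊕ V →₀ ℚ) →ₗ[ℚ] ℚ := Finsupp.linearCombination ℚ (fun _ => (1 : ℚ))
    have hle : Submodule.span ℚ (Set.range b) ≤ LinearMap.ker sumCoeff := by
      rw [Submodule.span_le]
      rintro _ ⟨e, rfl⟩
      simp [sumCoeff, b]
    intro h
    have := hle h
    simp [sumCoeff] at this
  have hcard := linearIndependent_le_span' _ (linearIndependent_option'.2 ⟨hb, hnone⟩)
    ((((A.image Q.split.s) ∪ (A.image Q.split.t)).image fun v => Finsupp.single v (1 : ℚ) :
      Finset (V ⊕ V →₀ ℚ)) : Set (V ⊕ V →₀ ℚ)) ?_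
  · have h1 : (A.image Q.split.s).card = (A.image Q.s).card := by
      rw [← Finset.card_image_of_injective (A.image Q.s) Sum.inl_injective (β := V ⊕ V),
        Finset.image_image]
      rfl
    have h2 : (A.image Q.split.t).card = (A.image Q.t).card := by
      rw [← Finset.card_image_of_injective (A.image Q.t) Sum.inr_injective (β := V ⊕ V),
        Finset.image_image]
      rfl
    have h3 := (Finset.card_image_le (s := (A.image Q.split.s) ∪ (A.image Q.split.t))
      (f := fun v => Finsupp.single v (1 : ℚ))).trans (Finset.card_union_le _ _)
    have h4 : Cardinal.mk (Option A) = ((A.card + 1 : ℕ) : Cardinal) := by simp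
    have h5 := (Nat.cast_le.1 (h4.ge.trans hcard)).trans_eq (Fintype.card_coe _)
    omega
  · rintro _ ⟨_ | e, rfl⟩
    · refine Submodule.subset_span ?_
      simp only [Finset.coe_image, Finset.coe_union]
      exact ⟨_, .inl ⟨e₀, he₀, rfl⟩, rfl⟩
    · refine Submodule.sub_mem _ (Submodule.subset_span ?_) (Submodule.subset_span ?_)
      · simp only [Finset.coe_image, Finset.coe_union]
        exact ⟨_, .inr ⟨e, e.2, rfl⟩, rfl⟩
      · simp only [Finset.coe_image, Finset.coe_union]
        exact ⟨_, .inl ⟨e, e.2, rfl⟩, rfl⟩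

/-- In every nonempty set of edges of a forest there is an edge whose conflicting edges are
pairwise in conflict. -/
theorem IsForest.exists_simplicial [Finite E] (hQ : Q.IsForest) {A : Finset E} (hA : A.Nonempty) :
    ∃ e ∈ A, ∀ f ∈ A, ∀ g ∈ A, Q.Conflict e f → Q.Conflict e g → Q.Conflict f g := by
  obtain ⟨e, he, h | h⟩ := hQ.exists_leaf hA
  · refine ⟨e, he, fun f hf g hg hef heg => ?_⟩
    rcases hef with hef | hef
    · rwa [h f hf hef.symm]
    · rcases heg with heg | heg
      · rw [h g hg heg.symm]
        exact .inr hef.symm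
      · exact .inr (hef.symm.trans heg)
  · refine ⟨e, he, fun f hf g hg hef heg => ?_⟩
    rcases hef with hef | hef
    · rcases heg with heg | heg
      · exact .inl (hef.symm.trans heg)
      · rw [h g hg heg.symm]
        exact .inl hef.symm
    · rwa [h f hf hef.symm]

/-! ### Multipaths in forests -/

/-- A connected subquiver of a forest is a simple path if it has an edge and no two of its edges
have the same source or the same target. The path is a longest chain of composable edges. -/
theorem IsForest.isSimplePath_of_connected [Finite E] (hQ : Q.IsForest) {C : Subquiver Q}
    (hC : C.Connected) (hne : C.edges.Nonempty)
    (hinj : ∀ e ∈ C.edges, ∀ f ∈ C.edges, Q.Conflict e f → e = f) : C.IsSimplePath := by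
  classical
  have := Fintype.ofFinite E
  -- chains of composable edges of `C`
  let Chain (n : ℕ) (e : Fin (n + 1) → E) : Prop :=
    Function.Injective e ∧ (∀ i, e i ∈ C.edges) ∧
      ∀ i : Fin n, Q.s (e i.succ) = Q.t (e i.castSucc)
  obtain ⟨e₀, he₀⟩ := hne
  have hbdd : ∀ n, (∃ e, Chain n e) → n ≤ Fintype.card E := by
    rintro n ⟨e, he, -⟩
    have := Fintype.card_le_of_injective e he
    simp at this
    omega
  have h0 : ∃ e, Chain 0 e :=
    ⟨fun _ => e₀, fun i j _ => Subsingleton.elim (α := Fin 1) i j, fun _ => he₀, fun i => i.elim0⟩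
  let n := Nat.findGreatest (fun n => ∃ e, Chain n e) (Fintype.card E)
  obtain ⟨e, hei, heC, hec⟩ : ∃ e, Chain n e :=
    Nat.findGreatest_spec (P := fun n => ∃ e, Chain n e) (Nat.zero_le _) h0
  have hmax : ∀ e', ¬ Chain (n + 1) e' := fun e' he' => by
    have := Nat.le_findGreatest (P := fun n => ∃ e, Chain n e) (hbdd _ ⟨e', he'⟩) ⟨e', he'⟩
    omega
  have hends : Q.s (e 0) ≠ Q.t (e (Fin.last n)) :=
    hQ.s_zero_ne_t_last hei hec
  -- an edge that meets the chain belongs to it, for otherwise it would extend the chain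
  have hs : ∀ f ∈ C.edges, ∀ i, Q.s f = Q.t (e i) → f ∈ Set.range e := by
    intro f hf i hfi
    rcases Fin.eq_castSucc_or_eq_last i with ⟨j, rfl⟩ | rfl
    · exact ⟨j.succ, (hinj f hf _ (heC _) (.inl (hfi.trans (hec j).symm))).symm⟩
    by_contra hfe
    refine hmax (Fin.snoc e f) ⟨?_, fun i => ?_, fun i => ?_⟩
    · exact Fin.snoc_injective_iff.2 ⟨hei, hfe⟩
    · induction i using Fin.lastCases with
      | last => simpa using hf
      | cast i => simpa using heC i
    · induction i using Fin.lastCases with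
      | last => simpa using hfi
      | cast i => simpa only [Fin.succ_castSucc, Fin.snoc_castSucc] using hec i
  have ht : ∀ f ∈ C.edges, ∀ i, Q.t f = Q.s (e i) → f ∈ Set.range e := by
    intro f hf i hfi
    rcases Fin.eq_zero_or_eq_succ i with rfl | ⟨j, rfl⟩
    · by_contra hfe
      refine hmax (Fin.cons f e) ⟨?_, fun i => ?_, fun i => ?_⟩
      · exact Fin.cons_injective_iff.2 ⟨hfe, hei⟩
      · induction i using Fin.cases with
        | zero => simpa using hf
        | succ i => simpa using heC i
      · induction i using Fin.cases with
        | zero => simpa using hfi.symm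
        | succ i => simpa only [← Fin.succ_castSucc, Fin.cons_succ] using hec i
    · exact ⟨j.castSucc, (hinj f hf _ (heC _) (.inr (hfi.trans (hec j)))).symm⟩
  let P : V → Prop := fun v => ∃ i, v = Q.s (e i) ∨ v = Q.t (e i)
  have hPs : ∀ f ∈ C.edges, P (Q.s f) → f ∈ Set.range e := by
    rintro f hf ⟨i, h | h⟩
    · exact ⟨i, (hinj f hf _ (heC i) (.inl h)).symm⟩
    · exact hs f hf i h
  have hPt : ∀ f ∈ C.edges, P (Q.t f) → f ∈ Set.range e := by
    rintro f hf ⟨i, h | h⟩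
    · exact ht f hf i h
    · exact ⟨i, (hinj f hf _ (heC i) (.inr h)).symm⟩
  have hP : ∀ u v, Relation.EqvGen C.Step u v → (P u ↔ P v) := by
    intro u v huv
    induction huv with
    | rel x y h =>
      obtain ⟨f, hf, rfl, rfl⟩ := h
      constructor
      · intro h
        obtain ⟨i, rfl⟩ := hPs f hf h
        exact ⟨i, .inr rfl⟩
      · intro h
        obtain ⟨i, rfl⟩ := hPt f hf h
        exact ⟨i, .inl rfl⟩
    | refl x => exact Iff.rfl
    | symm x y h ih => exact ih.symm
    | trans x y z h1 h2 ih1 ih2 => exact ih1.trans ih2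
  have hall : ∀ v ∈ C.verts, P v := fun v hv =>
    (hP _ _ (hC.2 _ (C.s_mem _ (heC 0)) v hv)).1 ⟨0, .inl rfl⟩
  refine ⟨n, e, ⟨?_, ?_, hec, fun i j hij => hei (hinj _ (heC i) _ (heC j) hij)⟩, hends⟩
  · exact Set.Subset.antisymm (fun f hf => hPs f hf (hall _ (C.s_mem f hf)))
      (Set.range_subset_iff.2 heC)
  · refine Set.Subset.antisymm (fun v hv => ?_) (Set.union_subset ?_ ?_)
    · obtain ⟨i, rfl | rfl⟩ := hall v hv
      · exact .inl ⟨_, heC i, rfl⟩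
      · exact .inr ⟨_, heC i, rfl⟩
    · rintro _ ⟨f, hf, rfl⟩
      exact C.s_mem f hf
    · rintro _ ⟨f, hf, rfl⟩
      exact C.t_mem f hf

/-- In a forest, a set of edges is the edge set of a multipath if and only if no two of its edges
are in conflict. -/
theorem IsForest.isMultipath_iff [Finite E] (hQ : Q.IsForest) {σ : Set E} :
    Q.IsMultipath (Q.spanning σ) ↔ ∀ e ∈ σ, ∀ f ∈ σ, Q.Conflict e f → e = f := by
  constructor
  · intro h e he f hf hef
    let P : Subquiver Q :=
      { verts := {Q.s e, Q.t e, Q.s f, Q.t f}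
        edges := {e, f}
        s_mem := by rintro _ (rfl | rfl) <;> simp
        t_mem := by rintro _ (rfl | rfl) <;> simp }
    have hP : P.Connected := by
      refine ⟨⟨Q.s e, by simp [P]⟩, ?_⟩
      have he' : Relation.EqvGen P.Step (Q.s e) (Q.t e) := .rel _ _ ⟨e, .inl rfl, rfl, rfl⟩
      have hf' : Relation.EqvGen P.Step (Q.s f) (Q.t f) := .rel _ _ ⟨f, .inr rfl, rfl, rfl⟩
      have hsf : Relation.EqvGen P.Step (Q.s e) (Q.s f) := by
        rcases hef with h | h
        · rw [h]
          exact .refl _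
        · rw [h] at he'
          exact he'.trans _ _ _ hf'.symm
      have key : ∀ v ∈ P.verts, Relation.EqvGen P.Step (Q.s e) v := by
        rintro v (rfl | rfl | rfl | rfl)
        · exact .refl _
        · exact he'
        · exact hsf
        · exact hsf.trans _ _ _ hf'
      exact fun u hu v hv => (key u hu).symm.trans _ _ _ (key v hv)
    obtain ⟨D, hD, hPD⟩ := Subquiver.exists_component (H := Q.spanning σ) (C := P)
      ⟨fun _ _ => trivial, by rintro _ (rfl | rfl) <;> assumption⟩ hP
    have heD : e ∈ D.edges := hPD.2 (.inl rfl)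
    have hfD : f ∈ D.edges := hPD.2 (.inr rfl)
    rcases h.2 D hD with hv | ⟨n, p, ⟨hp, -, -, hinj⟩, -⟩
    · simp [hv.2] at heD
    · rw [hp] at heD hfD
      obtain ⟨i, rfl⟩ := heD
      obtain ⟨j, rfl⟩ := hfD
      rw [hinj i j hef]
  · intro h
    refine ⟨rfl, fun C hC => ?_⟩
    obtain ⟨⟨hCσ, hc⟩, -⟩ := hC
    rcases Set.eq_empty_or_nonempty C.edges with he | hne
    · exact .inl (Subquiver.isVertex_of_edges_eq_empty hc he)
    · exact .inr (hQ.isSimplePath_of_connected hc hne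
        fun e he f hf => h e (hCσ.2 he) f (hCσ.2 hf))

end DirQuiver

namespace DirQuiver

variable {V E : Type*} {Q : DirQuiver V E}

/-! ### Dynamical modules of forests -/

/-- The subquiver spanned by the edges that are joined to `e` by a sequence of conflicts. -/
def conflictClass (Q : DirQuiver V E) (e : E) : Subquiver Q where
  verts := Q.s '' {f | Relation.EqvGen Q.Conflict e f} ∪ Q.t '' {f | Relation.EqvGen Q.Conflict e f}
  edges := {f | Relation.EqvGen Q.Conflict e f}
  s_mem f hf := .inl ⟨f, hf, rfl⟩
  t_mem f hf := .inr ⟨f, hf, rfl⟩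

theorem mem_conflictClass_self (e : E) : e ∈ (Q.conflictClass e).edges := .refl _

theorem conflictClass_eq_of_mem {e f : E} (h : f ∈ (Q.conflictClass e).edges) :
    Q.conflictClass f = Q.conflictClass e := by
  have h' : {g | Relation.EqvGen Q.Conflict f g} = {g | Relation.EqvGen Q.Conflict e g} := by
    ext g
    exact ⟨fun hg => h.trans _ _ _ hg, fun hg => h.symm.trans _ _ _ hg⟩
  ext1
  · simp only [conflictClass, h']
  · exact h'

theorem eqvGen_split_of_eqvGen_conflict {e f : E} (h : Relation.EqvGen Q.Conflict e f) :
    Relation.EqvGen Q.split.whole.Step (.inl (Q.s e)) (.inl (Q.s f)) := by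
  have hstep : ∀ e, Relation.EqvGen Q.split.whole.Step (.inl (Q.s e)) (.inr (Q.t e)) :=
    fun e => .rel _ _ ⟨e, trivial, rfl, rfl⟩
  induction h with
  | rel x y h =>
    rcases h with h | h
    · rw [h]
      exact .refl _
    · have := hstep x
      rw [h] at this
      exact this.trans _ _ _ (hstep y).symm
  | refl x => exact .refl _
  | symm x y h ih => exact ih.symm
  | trans x y z h1 h2 ih1 ih2 => exact ih1.trans _ _ _ ih2

/-- All vertices of a conflict class of a forest are stable in it: such a class is a component of
the split quiver, and does not contain both halves of a vertex. -/
theorem IsForest.s_ne_t_of_eqvGen_conflict [Finite E] (hQ : Q.IsForest) {e f : E}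
    (h : Relation.EqvGen Q.Conflict e f) : Q.s e ≠ Q.t f := by
  intro heq
  refine hQ.not_eqvGen_split (H := Q.split.whole) (Q.s e)
    ((eqvGen_split_of_eqvGen_conflict h).trans _ _ _ ?_)
  rw [heq]
  exact .rel _ _ ⟨f, trivial, rfl, rfl⟩

/-- A dynamical region contains with an edge all edges in conflict with it. -/
theorem IsDynamicalRegion.mem_of_conflict {R : Subquiver Q} (hR : Q.IsDynamicalRegion R) {e f : E}
    (he : e ∈ R.edges) (hef : Q.Conflict e f) : f ∈ R.edges := by
  by_contra hf
  rcases hef with h | h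
  · have hv : Q.s e ∈ R.boundary := ⟨R.s_mem e he, .inl ⟨f, hf, h.symm⟩⟩
    obtain ⟨h1, h2, h3⟩ := hR.2.2.1 _ hv
    obtain ⟨-, g, -, hg⟩ := not_not.1 h1
    by_cases hgR : g ∈ R.edges
    · exact h2 ⟨⟨e, he, rfl⟩, ⟨g, hgR, hg⟩⟩
    · exact h3 ⟨⟨f, hf, h.symm⟩, ⟨g, hgR, hg⟩⟩
  · have hv : Q.t e ∈ R.boundary := ⟨R.t_mem e he, .inr ⟨f, hf, h.symm⟩⟩
    obtain ⟨h1, h2, h3⟩ := hR.2.2.1 _ hv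
    obtain ⟨⟨g, -, hg⟩, -⟩ := not_not.1 h1
    by_cases hgR : g ∈ R.edges
    · exact h2 ⟨⟨g, hgR, hg⟩, ⟨e, he, rfl⟩⟩
    · exact h3 ⟨⟨g, hgR, hg⟩, ⟨f, hf, h.symm⟩⟩

theorem IsDynamicalRegion.conflictClass_le {R : Subquiver Q} (hR : Q.IsDynamicalRegion R) {e : E}
    (he : e ∈ R.edges) : Q.conflictClass e ≤ R := by
  have key : ∀ f g, Relation.EqvGen Q.Conflict f g → (f ∈ R.edges ↔ g ∈ R.edges) := by
    intro f g h
    induction h with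
    | rel x y h => exact ⟨fun hx => hR.mem_of_conflict hx h, fun hy => hR.mem_of_conflict hy h.symm⟩
    | refl x => exact Iff.rfl
    | symm x y h ih => exact ih.symm
    | trans x y z h1 h2 ih1 ih2 => exact ih1.trans ih2
  refine ⟨?_, fun f hf => (key e f hf).1 he⟩
  rintro _ (⟨f, hf, rfl⟩ | ⟨f, hf, rfl⟩)
  · exact R.s_mem f ((key e f hf).1 he)
  · exact R.t_mem f ((key e f hf).1 he)

theorem conflictClass_connected (e : E) : (Q.conflictClass e).Connected := by
  have hstep : ∀ f ∈ (Q.conflictClass e).edges,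
      Relation.EqvGen (Q.conflictClass e).Step (Q.s f) (Q.t f) :=
    fun f hf => .rel _ _ ⟨f, hf, rfl, rfl⟩
  have key : ∀ f g, Relation.EqvGen Q.Conflict f g → f ∈ (Q.conflictClass e).edges →
      Relation.EqvGen (Q.conflictClass e).Step (Q.s f) (Q.s g) := by
    intro f g h
    induction h with
    | rel x y h =>
      intro hx
      have hy : y ∈ (Q.conflictClass e).edges := Relation.EqvGen.trans _ _ _ hx (.rel _ _ h)
      rcases h with h | h
      · rw [h]
        exact .refl _
      · have := hstep x hx
        rw [h] at this
        exact this.trans _ _ _ (hstep y hy).symm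
    | refl x => exact fun _ => .refl _
    | symm x y h ih => exact fun hy => (ih (Relation.EqvGen.trans _ _ _ hy h.symm)).symm
    | trans x y z h1 h2 ih1 ih2 =>
      exact fun hx => (ih1 hx).trans _ _ _ (ih2 (Relation.EqvGen.trans _ _ _ hx h1))
  have hall : ∀ v ∈ (Q.conflictClass e).verts,
      Relation.EqvGen (Q.conflictClass e).Step (Q.s e) v := by
    rintro _ (⟨f, hf, rfl⟩ | ⟨f, hf, rfl⟩)
    · exact key _ _ hf (mem_conflictClass_self e)
    · exact (key _ _ hf (mem_conflictClass_self e)).trans _ _ _ (hstep f hf)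
  exact ⟨⟨_, Subquiver.s_mem _ e (mem_conflictClass_self e)⟩,
    fun u hu v hv => (hall u hu).symm.trans _ _ _ (hall v hv)⟩

theorem IsForest.isDynamicalRegion_conflictClass [Finite E] (hQ : Q.IsForest) (e : E) :
    Q.IsDynamicalRegion (Q.conflictClass e) := by
  have hlink : ∀ {f g}, f ∈ (Q.conflictClass e).edges → Q.Conflict f g →
      g ∈ (Q.conflictClass e).edges := fun hf h => hf.trans _ _ _ (.rel _ _ h)
  refine ⟨conflictClass_connected e, ⟨e, mem_conflictClass_self e⟩, ?_,
    fun C hC => (hQ.not_isOrientedCycle C hC).elim⟩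
  have hst : ∀ v, (Q.conflictClass e).StableVertex v := by
    rintro v ⟨⟨f, hf, rfl⟩, ⟨g, hg, h⟩⟩
    exact hQ.s_ne_t_of_eqvGen_conflict (hf.symm.trans _ _ _ hg) h.symm
  rintro v ⟨⟨f, hf, rfl⟩ | ⟨f, hf, rfl⟩, ⟨g, hg, h⟩ | ⟨g, hg, h⟩⟩
  · exact absurd (hlink hf (.inl h.symm)) hg
  · refine ⟨not_not.2 ⟨⟨f, trivial, rfl⟩, ⟨g, trivial, h⟩⟩, hst _, ?_⟩
    rintro ⟨⟨k, hk, h'⟩, -⟩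
    exact hk (hlink hf (.inl h'.symm))
  · refine ⟨not_not.2 ⟨⟨g, trivial, h⟩, ⟨f, trivial, rfl⟩⟩, hst _, ?_⟩
    rintro ⟨-, ⟨k, hk, h'⟩⟩
    exact hk (hlink hf (.inr h'.symm))
  · exact absurd (hlink hf (.inr h.symm)) hg

/-- The conflict classes of a forest are dynamical modules. That there are no others is
`eq_conflictClass`. -/
theorem IsForest.isDynamicalModule_conflictClass [Finite E] (hQ : Q.IsForest) (e : E) :
    Q.IsDynamicalModule (Q.conflictClass e) := by
  refine ⟨hQ.isDynamicalRegion_conflictClass e, fun R hR hle => ?_⟩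
  obtain ⟨f, hf⟩ := hR.2.1
  rw [← conflictClass_eq_of_mem (hle.2 hf)]
  exact hR.conflictClass_le hf

theorem IsForest.eq_conflictClass [Finite E] (hQ : Q.IsForest) {M : Subquiver Q}
    (hM : Q.IsDynamicalModule M) {e : E} (he : e ∈ M.edges) : M = Q.conflictClass e :=
  (hM.eq_of_le (hQ.isDynamicalRegion_conflictClass e) (hM.1.conflictClass_le he)).symm

/-- All vertices of a dynamical module of a forest are stable in it. -/
theorem IsForest.s_ne_t_of_mem_module [Finite E] (hQ : Q.IsForest) {M : Subquiver Q}
    (hM : Q.IsDynamicalModule M) {e f : E} (he : e ∈ M.edges) (hf : f ∈ M.edges) :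
    Q.s e ≠ Q.t f := by
  rw [hQ.eq_conflictClass hM he] at hf
  exact hQ.s_ne_t_of_eqvGen_conflict hf

theorem IsForest.isStableRegion [Finite E] (hQ : Q.IsForest) {M : Subquiver Q}
    (hM : Q.IsDynamicalModule M) : Q.IsStableRegion M := by
  rintro v ⟨hv, hvb⟩ ⟨⟨f, -, hf⟩, ⟨g, -, hg⟩⟩
  have hfM : f ∈ M.edges := by
    by_contra h
    exact hvb ⟨hv, .inl ⟨f, h, hf⟩⟩
  have hgM : g ∈ M.edges := by
    by_contra h
    exact hvb ⟨hv, .inr ⟨g, h, hg⟩⟩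
  exact hQ.s_ne_t_of_mem_module hM hfM hgM (hf.trans hg.symm)

theorem IsForest.underlyingGraph_isTree [Finite E] (hQ : Q.IsForest) {H : Subquiver Q}
    (hH : H.Connected) : H.underlyingGraph.IsTree := by
  constructor
  · have key : ∀ u v, Relation.EqvGen H.Step u v → u = v ∨
        ∃ (hu : u ∈ H.verts) (hv : v ∈ H.verts), H.underlyingGraph.Reachable ⟨u, hu⟩ ⟨v, hv⟩ := by
      intro u v h
      induction h with
      | rel x y h =>
        by_cases hxy : x = y
        · exact .inl hxy
        obtain ⟨e, he, rfl, rfl⟩ := h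
        refine .inr ⟨H.s_mem e he, H.t_mem e he, SimpleGraph.Adj.reachable
          ⟨fun h => hxy (congrArg Subtype.val h), .inl ⟨e, he, rfl, rfl⟩⟩⟩
      | refl x => exact .inl rfl
      | symm x y h ih =>
        rcases ih with h | ⟨hx, hy, h⟩
        · exact .inl h.symm
        · exact .inr ⟨hy, hx, h.symm⟩
      | trans x y z h1 h2 ih1 ih2 =>
        rcases ih1 with rfl | ⟨hx, hy, h⟩
        · exact ih2
        rcases ih2 with rfl | ⟨hy', hz, h'⟩
        · exact .inr ⟨hx, hy, h⟩
        · exact .inr ⟨hx, hz, h.trans h'⟩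
    have := hH.1.to_subtype
    refine ⟨fun u v => ?_⟩
    rcases key _ _ (hH.2 u u.2 v v.2) with h | ⟨_, _, h⟩
    · rw [Subtype.ext h]
    · exact h
  · rw [SimpleGraph.isAcyclic_iff_forall_adj_isBridge]
    intro u v huv
    rw [SimpleGraph.isBridge_iff]
    intro hr
    obtain ⟨e, he⟩ : ∃ e, s(Q.s e, Q.t e) = s(u.1, v.1) := by
      rcases huv.2 with ⟨e, -, h1, h2⟩ | ⟨e, -, h1, h2⟩
      · exact ⟨e, by rw [h1, h2]⟩
      · exact ⟨e, by rw [h1, h2, Sym2.eq_swap]⟩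
    have key : ∀ {x y : H.verts}, (H.underlyingGraph.deleteEdges {s(u, v)}).Walk x y →
        Relation.EqvGen (Q.spanning {e}ᶜ).Step x.1 y.1 := by
      intro x y p
      induction p with
      | nil => exact .refl _
      | @cons x y z h p ih =>
        obtain ⟨h1, h2⟩ := SimpleGraph.deleteEdges_adj.1 h
        have hne : s(x.1, y.1) ≠ s(Q.s e, Q.t e) := fun h =>
          h2 (Sym2.map.injective Subtype.val_injective (h.trans he))
        refine Relation.EqvGen.trans _ _ _ ?_ ih
        rcases h1.2 with ⟨f, -, h1, h2⟩ | ⟨f, -, h1, h2⟩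
        · refine .rel _ _ ⟨f, ?_, h1, h2⟩
          rintro rfl
          rw [h1, h2] at hne
          exact hne rfl
        · refine .symm _ _ (.rel _ _ ⟨f, ?_, h1, h2⟩)
          rintro rfl
          rw [h1, h2, Sym2.eq_swap] at hne
          exact hne rfl
    obtain ⟨p⟩ := hr
    replace key := key p
    refine hQ.not_eqvGen_of_notMem (H := Q.spanning {e}ᶜ) (e := e) (fun h => h rfl) ?_
    rcases Sym2.eq_iff.1 he with ⟨h1, h2⟩ | ⟨h1, h2⟩
    · rwa [h1, h2]
    · rw [h1, h2]
      exact key.symm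

/-! ### The multipath complex as a join of matching complexes -/

section Join

variable [Finite E] (hQ : Q.IsForest)

/-- The edge of the underlying graph of a dynamical module given by an edge of a forest. -/
def IsForest.moduleEdge (e : E) : Σ M : {M : Subquiver Q // Q.IsDynamicalModule M},
    M.1.underlyingGraph.edgeSet :=
  ⟨⟨Q.conflictClass e, hQ.isDynamicalModule_conflictClass e⟩,
    s(⟨Q.s e, Subquiver.s_mem _ e (mem_conflictClass_self e)⟩,
      ⟨Q.t e, Subquiver.t_mem _ e (mem_conflictClass_self e)⟩),
    fun h => hQ.s_ne_t e (congrArg Subtype.val h),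
    .inl ⟨e, mem_conflictClass_self e, rfl, rfl⟩⟩

theorem IsForest.mem_moduleEdge {e : E} {v : (hQ.moduleEdge e).1.1.verts} :
    v ∈ (hQ.moduleEdge e).2.1 ↔ v.1 = Q.s e ∨ v.1 = Q.t e :=
  Sym2.mem_iff.trans (or_congr Subtype.ext_iff Subtype.ext_iff)

theorem IsForest.moduleEdge_bijective : Function.Bijective hQ.moduleEdge := by
  constructor
  · intro e f h
    let ends : (Σ M : {M : Subquiver Q // Q.IsDynamicalModule M},
        M.1.underlyingGraph.edgeSet) → Sym2 V := fun x => x.2.1.map Subtype.val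
    exact hQ.eq_of_sym2_eq (congrArg ends h)
  · rintro ⟨⟨M, hM⟩, ⟨x, hx⟩⟩
    induction x using Sym2.ind with
    | _ u v =>
    rcases hx.2 with ⟨e, he, h1, h2⟩ | ⟨e, he, h1, h2⟩
    · obtain rfl := hQ.eq_conflictClass hM he
      refine ⟨e, Sigma.ext rfl (heq_of_eq (Subtype.ext ?_))⟩
      exact Sym2.eq_iff.2 (.inl ⟨Subtype.ext h1, Subtype.ext h2⟩)
    · obtain rfl := hQ.eq_conflictClass hM he
      refine ⟨e, Sigma.ext rfl (heq_of_eq (Subtype.ext ?_))⟩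
      exact Sym2.eq_iff.2 (.inr ⟨Subtype.ext h1, Subtype.ext h2⟩)

theorem IsForest.mem_multipathComplex_iff {σ : Finset E} :
    σ ∈ Q.multipathComplex.faces ↔ (σ.map ⟨_, hQ.moduleEdge_bijective.1⟩) ∈
      (join (fun M : {M : Subquiver Q // Q.IsDynamicalModule M} =>
        matchingComplex M.1.underlyingGraph)).faces := by
  have hpre : ∀ (M : {M : Subquiver Q // Q.IsDynamicalModule M}) (a),
      a ∈ ((σ.map ⟨_, hQ.moduleEdge_bijective.1⟩).preimage (Sigma.mk M)
        sigma_mk_injective.injOn) ↔ ∃ e ∈ σ, hQ.moduleEdge e = ⟨M, a⟩ := by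
    intro M a
    simp
  have hmem : ∀ {e : E} {x}, hQ.moduleEdge e = x →
      e ∈ x.1.1.edges ∧ ∀ v, v ∈ x.2.1 ↔ v.1 = Q.s e ∨ v.1 = Q.t e := by
    rintro e x rfl
    exact ⟨mem_conflictClass_self e, fun v => hQ.mem_moduleEdge⟩
  refine and_congr (by simp) ?_
  refine hQ.isMultipath_iff.trans ⟨fun h M hM => ⟨hM, ?_⟩, fun h e he f hf hef => ?_⟩
  · intro a ha b hb hab v hva hvb
    obtain ⟨e, he, hea⟩ := (hpre M a).1 ha
    obtain ⟨f, hf, hfb⟩ := (hpre M b).1 hb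
    obtain ⟨heM, hve⟩ := hmem hea
    obtain ⟨hfM, hvf⟩ := hmem hfb
    have hne : ¬ Q.Conflict e f := fun hc => by
      obtain rfl := h e he f hf hc
      exact hab (eq_of_heq (Sigma.ext_iff.1 (hea.symm.trans hfb)).2)
    rcases (hve v).1 hva with h1 | h1 <;> rcases (hvf v).1 hvb with h2 | h2
    · exact hne (.inl (h1.symm.trans h2))
    · exact hQ.s_ne_t_of_mem_module M.2 heM hfM (h1.symm.trans h2)
    · exact hQ.s_ne_t_of_mem_module M.2 hfM heM (h2.symm.trans h1)
    · exact hne (.inr (h1.symm.trans h2))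
  · by_contra hne
    obtain ⟨b, hb⟩ : ∃ b, hQ.moduleEdge f = ⟨(hQ.moduleEdge e).1, b⟩ := by
      have h1 : (hQ.moduleEdge f).1 = (hQ.moduleEdge e).1 :=
        Subtype.ext (conflictClass_eq_of_mem (.rel _ _ hef))
      rw [← h1]
      exact ⟨_, rfl⟩
    have ha' := (hpre _ (hQ.moduleEdge e).2).2 ⟨e, he, rfl⟩
    have hb' := (hpre _ b).2 ⟨f, hf, hb⟩
    have hab : (hQ.moduleEdge e).2 ≠ b := by
      rintro rfl
      exact hne (hQ.moduleEdge_bijective.1 hb.symm)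
    have hdisj := (h _ ⟨_, ha'⟩).2 _ ha' _ hb' hab
    rcases hef with hef | hef
    · exact hdisj ⟨Q.s e, Subquiver.s_mem _ e (hmem rfl).1⟩ (((hmem rfl).2 _).2 (.inl rfl))
        (((hmem hb).2 _).2 (.inl hef))
    · exact hdisj ⟨Q.t e, Subquiver.t_mem _ e (hmem rfl).1⟩ (((hmem rfl).2 _).2 (.inr rfl))
        (((hmem hb).2 _).2 (.inr hef))

end Join

end DirQuiver

/-- Isomorphic simplicial complexes have homeomorphic realizations. -/
def realizationCongr {α β : Type*} (φ : α ≃ β) {K : PreAbstractSimplicialComplex α}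
    {L : PreAbstractSimplicialComplex β}
    (h : ∀ σ, σ ∈ K.faces ↔ σ.map φ.toEmbedding ∈ L.faces) :
    realization K ≃ₜ realization L where
  toFun x := ⟨fun b => x.1 (φ.symm b), fun b => x.2.1 _, by
    obtain ⟨σ, hσ, h0, h1⟩ := x.2.2
    refine ⟨σ.map φ.toEmbedding, (h σ).1 hσ, fun b hb => h0 _ fun hb' => hb ?_, ?_⟩
    · exact Finset.mem_map.2 ⟨_, hb', by simp⟩
    · simpa using h1⟩
  invFun y := ⟨fun a => y.1 (φ a), fun a => y.2.1 _, by
    obtain ⟨σ, hσ, h0, h1⟩ := y.2.2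
    refine ⟨σ.map φ.symm.toEmbedding, (h _).2 ?_, fun a ha => h0 _ fun ha' => ha ?_, ?_⟩
    · convert hσ
      ext
      simp
    · exact Finset.mem_map.2 ⟨_, ha', by simp⟩
    · simpa using h1⟩
  left_inv x := Subtype.ext (funext fun a => by simp)
  right_inv y := Subtype.ext (funext fun b => by simp)
  continuous_toFun := Continuous.subtype_mk
    (continuous_pi fun b => (continuous_apply (φ.symm b)).comp
      (continuous_subtype_val (p := (· ∈ realization K)))) _
  continuous_invFun := Continuous.subtype_mk
    (continuous_pi fun a => (continuous_apply (φ a)).comp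
      (continuous_subtype_val (p := (· ∈ realization L)))) _

/-! ### Collapsible complexes -/

section Collapse

variable {α : Type*}

/-- A set of finite sets, thought of as a simplicial complex which may have the empty set as a
face, is collapsible if it can be exhausted by elementary collapses: one removes the faces that
contain a face `τ`, of which there are only `τ` and `insert a τ`. As `τ = ∅` is allowed, a point
collapses to the void complex. -/
inductive Collapsible [DecidableEq α] : Set (Finset α) → Prop
  | void : Collapsible ∅
  | step (S : Set (Finset α)) (τ : Finset α) (a : α) (ha : a ∉ τ) (hτ : insert a τ ∈ S)
      (hfree : ∀ ρ ∈ S, τ ⊆ ρ → ρ ⊆ insert a τ) (h : Collapsible {ρ ∈ S | ¬ τ ⊆ ρ}) : Collapsible S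

/-- A cone over a finite complex is collapsible. -/
theorem collapsible_of_cone [DecidableEq α] (v : α) (S : Finset (Finset α))
    (hS : IsLowerSet (S : Set (Finset α)))
    (hv : ∀ σ ∈ S, insert v σ ∈ S) : Collapsible (S : Set (Finset α)) := by
  induction h : S.card using Nat.strong_induction_on generalizing S with
  | _ n ih =>
  subst h
  rcases S.eq_empty_or_nonempty with rfl | hne
  · simpa using Collapsible.void
  -- a face `σ` of maximal cardinality contains `v`, and `σ.erase v` is a free face of it
  obtain ⟨σ, hσ, hmax⟩ := S.exists_max_image Finset.card hne
  have hvσ : v ∈ σ := by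
    by_contra h
    have := hmax _ (hv σ hσ)
    rw [Finset.card_insert_of_notMem h] at this
    omega
  have hins : insert v (σ.erase v) = σ := Finset.insert_erase hvσ
  have hfree : ∀ ρ ∈ S, σ.erase v ⊆ ρ → ρ ⊆ insert v (σ.erase v) := by
    intro ρ hρ hle
    have h1 : σ ⊆ insert v ρ := by
      rw [← hins]
      exact Finset.insert_subset_insert _ hle
    rw [hins, Finset.eq_of_subset_of_card_le h1 (hmax _ (hv ρ hρ))]
    exact Finset.subset_insert _ _
  have hlt : (S.filter fun ρ => ¬ σ.erase v ⊆ ρ).card < S.card :=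
    Finset.card_lt_card (Finset.filter_ssubset.2
      ⟨σ, hσ, not_not.2 (Finset.erase_subset _ _)⟩)
  have := ih _ hlt (S.filter fun ρ => ¬ σ.erase v ⊆ ρ) ?_ ?_ rfl
  · refine .step _ _ v (Finset.notMem_erase _ _) (by rw [hins]; exact hσ) hfree ?_
    simpa using this
  · intro ρ ρ' hle hρ
    simp only [Finset.coe_filter, Set.mem_ofPred_eq] at hρ ⊢
    exact ⟨hS hle hρ.1, fun h => hρ.2 (h.trans hle)⟩
  · intro ρ hρ
    simp only [Finset.mem_filter] at hρ ⊢
    refine ⟨hv ρ hρ.1, fun h => hρ.2 ?_⟩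
    intro a ha
    exact (Finset.mem_insert.1 (h ha)).resolve_left (Finset.ne_of_mem_erase ha)

/-- Attaching a cone over a collapsible subcomplex preserves collapsibility. -/
theorem Collapsible.union_cone [DecidableEq α] {S S' : Set (Finset α)} (hS : Collapsible S)
    (hS' : Collapsible S')
    {w : α} (hw : ∀ σ ∈ S, w ∉ σ) (hw' : ∀ σ ∈ S', w ∉ σ) :
    Collapsible (S ∪ insert w '' S') := by
  induction hS' with
  | void => simpa using hS
  | step T τ a ha hτ hfree h ih =>
    have hwa : w ∉ insert a τ := hw' _ hτ
    have hwτ : w ∉ τ := fun h => hwa (Finset.mem_insert_of_mem h)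
    have hne : a ≠ w := by
      rintro rfl
      exact hwa (Finset.mem_insert_self _ _)
    have key : ∀ ρ ∈ T, (insert w τ ⊆ insert w ρ ↔ τ ⊆ ρ) := fun ρ hρ =>
      Finset.insert_subset_insert_iff hwτ
    refine .step _ (insert w τ) a ?_ ?_ ?_ ?_
    · simp [hne, ha]
    · exact .inr ⟨_, hτ, Finset.insert_comm _ _ _⟩
    · rintro ρ (hρ | ⟨ρ, hρ, rfl⟩) hle
      · exact absurd (hle (Finset.mem_insert_self _ _)) (hw ρ hρ)
      · rw [Finset.insert_comm]
        exact Finset.insert_subset_insert _ (hfree ρ hρ ((key ρ hρ).1 hle))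
    · convert ih fun σ hσ => hw' σ hσ.1 using 1
      ext ρ
      constructor
      · rintro ⟨hρ | ⟨ρ, hρ, rfl⟩, hle⟩
        · exact .inl hρ
        · exact .inr ⟨ρ, ⟨hρ, fun h => hle ((key ρ hρ).2 h)⟩, rfl⟩
      · rintro (hρ | ⟨ρ, ⟨hρ, hle⟩, rfl⟩)
        · exact ⟨.inl hρ, fun h => hw ρ hρ (h (Finset.mem_insert_self _ _))⟩
        · exact ⟨.inr ⟨ρ, hρ, rfl⟩, fun h => hle ((key ρ hρ).1 h)⟩

/-! ### Independence complexes -/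

/-- The independent sets in `A` for a relation `r`: the subsets of `A` no two elements of which are
related. The empty set is included. -/
def indepSets (r : α → α → Prop) (A : Finset α) : Set (Finset α) :=
  {σ | σ ⊆ A ∧ ∀ a ∈ σ, ∀ b ∈ σ, r a b → a = b}

theorem isLowerSet_indepSets (r : α → α → Prop) (A : Finset α) : IsLowerSet (indepSets r A) :=
  fun _ _ hle h => ⟨hle.trans h.1, fun a ha b hb => h.2 a (hle ha) b (hle hb)⟩

theorem indepSets_mono (r : α → α → Prop) {A B : Finset α} (h : A ⊆ B) :
    indepSets r A ⊆ indepSets r B := fun _ hσ => ⟨hσ.1.trans h, hσ.2⟩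

theorem insert_mem_indepSets [DecidableEq α] {r : α → α → Prop} (hr : ∀ a b, r a b → r b a)
    {A : Finset α} {v : α}
    (hv : v ∈ A) {σ : Finset α} (hσ : σ ∈ indepSets r A) (h : ∀ a ∈ σ, r v a → v = a) :
    insert v σ ∈ indepSets r A := by
  refine ⟨Finset.insert_subset hv hσ.1, fun a ha b hb hab => ?_⟩
  rcases Finset.mem_insert.1 ha with rfl | ha' <;> rcases Finset.mem_insert.1 hb with rfl | hb'
  · rfl
  · exact h b hb' hab
  · exact (h a ha' (hr _ _ hab)).symm
  · exact hσ.2 a ha' b hb' hab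

/-- The independence complex of a graph in which every nonempty induced subgraph has a simplicial
vertex (that is, of a chordal graph) becomes collapsible when some of its facets are removed. For
a neighbour `w` of a simplicial vertex `v`, the complex consists of the independent sets without
`w` and a cone over the link of `w`, that is, over the independent sets without neighbours of `w`.
As the neighbours of `v` are neighbours of `w`, no face of the link is a facet of the first part. -/
theorem exists_facets_collapsible [DecidableEq α] (r : α → α → Prop)
    (hr : ∀ a b, r a b → r b a) (A : Finset α)
    (hA : ∀ B ⊆ A, B.Nonempty → ∃ v ∈ B, ∀ a ∈ B, ∀ b ∈ B, r v a → r v b → r a b) :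
    ∃ H ⊆ indepSets r A, (∀ σ ∈ H, ∀ ρ ∈ indepSets r A, σ ⊆ ρ → ρ = σ) ∧
      Collapsible (indepSets r A \ H) := by
  classical
  induction A using Finset.strongInduction with
  | H A ih =>
  rcases A.eq_empty_or_nonempty with rfl | hne
  · refine ⟨indepSets r ∅, subset_rfl, fun σ hσ ρ hρ _ => ?_, by simpa using Collapsible.void⟩
    rw [Finset.subset_empty.1 hσ.1, Finset.subset_empty.1 hρ.1]
  obtain ⟨v, hv, hsimp⟩ := hA A subset_rfl hne
  by_cases hiso : ∃ w ∈ A, w ≠ v ∧ r v w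
  · obtain ⟨w, hw, hwv, hvw⟩ := hiso
    let A₁ := A.erase w
    let A₂ := A₁.filter fun a => ¬ r w a
    have h1 : A₁ ⊂ A := Finset.erase_ssubset hw
    have h2 : A₂ ⊂ A := (Finset.filter_subset _ _).trans_ssubset h1
    have hw1 : w ∉ A₁ := Finset.notMem_erase _ _
    obtain ⟨H₁, hH₁, hmax₁, hc₁⟩ := ih A₁ h1 fun B hB => hA B (hB.trans h1.subset)
    obtain ⟨H₂, hH₂, hmax₂, hc₂⟩ := ih A₂ h2 fun B hB => hA B (hB.trans h2.subset)
    have hI2 : indepSets r A₂ ⊆ indepSets r A₁ := indepSets_mono r (Finset.filter_subset _ _)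
    have hwI : ∀ σ ∈ indepSets r A₁, w ∉ σ := fun σ hσ h => hw1 (hσ.1 h)
    -- independent sets containing `w` are cones over independent sets in `A₂`
    have hcone : ∀ σ, w ∉ σ → (insert w σ ∈ indepSets r A ↔ σ ∈ indepSets r A₂) := by
      intro σ hwσ
      constructor
      · intro h
        refine ⟨fun a ha => ?_, fun a ha b hb => h.2 a (Finset.mem_insert_of_mem ha) b
          (Finset.mem_insert_of_mem hb)⟩
        have haw : a ≠ w := fun h => hwσ (h ▸ ha)
        refine Finset.mem_filter.2 ⟨Finset.mem_erase.2 ⟨haw, h.1 (Finset.mem_insert_of_mem ha)⟩,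
          fun hwa => haw (h.2 w (Finset.mem_insert_self _ _) a (Finset.mem_insert_of_mem ha)
            hwa).symm⟩
      · intro h
        refine insert_mem_indepSets hr hw (indepSets_mono r h2.subset h) fun a ha hwa => ?_
        exact absurd hwa (Finset.mem_filter.1 (h.1 ha)).2
    have hsplit : indepSets r A = indepSets r A₁ ∪ insert w '' indepSets r A₂ := by
      ext σ
      constructor
      · intro h
        by_cases hwσ : w ∈ σ
        · refine .inr ⟨σ.erase w, (hcone _ (Finset.notMem_erase _ _)).1 ?_,
            Finset.insert_erase hwσ⟩
          rwa [Finset.insert_erase hwσ]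
        · exact .inl ⟨fun a ha => Finset.mem_erase.2 ⟨fun h => hwσ (h ▸ ha), h.1 ha⟩, h.2⟩
      · rintro (h | ⟨σ, h, rfl⟩)
        · exact indepSets_mono r h1.subset h
        · exact (hcone _ (hwI σ (hI2 h))).2 h
    -- no independent set in `A₂` is maximal in `A₁`, as it may be extended by `v`
    have hext : ∀ σ ∈ indepSets r A₂, ∃ ρ ∈ indepSets r A₁, σ ⊆ ρ ∧ ρ ≠ σ := by
      intro σ hσ
      have hvσ : ∀ a ∈ σ, ¬ r v a := fun a ha hva =>
        (Finset.mem_filter.1 (hσ.1 ha)).2 (hsimp w hw a (h2.subset (hσ.1 ha)) hvw hva)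
      have hvn : v ∉ σ := fun h => (Finset.mem_filter.1 (hσ.1 h)).2 (hr _ _ hvw)
      refine ⟨insert v σ, insert_mem_indepSets hr (Finset.mem_erase.2 ⟨hwv.symm, hv⟩) (hI2 hσ)
        fun a ha hva => absurd hva (hvσ a ha), Finset.subset_insert _ _, fun h => hvn ?_⟩
      rw [← h]
      exact Finset.mem_insert_self _ _
    have hdisj : ∀ σ ∈ indepSets r A₂, σ ∉ H₁ := by
      intro σ hσ hσH
      obtain ⟨ρ, hρ, hle, hne⟩ := hext σ hσ
      exact hne (hmax₁ σ hσH ρ hρ hle)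
    refine ⟨H₁ ∪ insert w '' H₂, ?_, ?_, ?_⟩
    · rw [hsplit]
      exact Set.union_subset_union hH₁ (Set.image_mono hH₂)
    · rintro _ (hσ | ⟨σ, hσ, rfl⟩) ρ hρ hle
      · rename_i σ
        rw [hsplit] at hρ
        rcases hρ with hρ | ⟨ρ, hρ, rfl⟩
        · exact hmax₁ σ hσ ρ hρ hle
        · have hwσ := hwI σ (hH₁ hσ)
          rw [Finset.subset_insert_iff_of_notMem hwσ] at hle
          exact absurd hσ (hdisj σ (isLowerSet_indepSets r A₂ hle hρ))
      · rw [hsplit] at hρ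
        have hwρ : w ∈ ρ := hle (Finset.mem_insert_self _ _)
        rcases hρ with hρ | ⟨ρ, hρ, rfl⟩
        · exact absurd hwρ (hwI ρ hρ)
        · rw [Finset.insert_subset_insert_iff (hwI σ (hI2 (hH₂ hσ)))] at hle
          rw [hmax₂ σ hσ ρ hρ hle]
    · convert hc₁.union_cone hc₂ (w := w) (fun σ hσ => hwI σ hσ.1) (fun σ hσ => hwI σ (hI2 hσ.1))
        using 1
      rw [hsplit]
      ext σ
      constructor
      · rintro ⟨hσ | ⟨σ, hσ, rfl⟩, hn⟩
        · exact .inl ⟨hσ, fun h => hn (.inl h)⟩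
        · exact .inr ⟨σ, ⟨hσ, fun h => hn (.inr ⟨σ, h, rfl⟩)⟩, rfl⟩
      · rintro (⟨hσ, hn⟩ | ⟨σ, ⟨hσ, hn⟩, rfl⟩)
        · refine ⟨.inl hσ, ?_⟩
          rintro (h | ⟨ρ, -, rfl⟩)
          · exact hn h
          · exact hwI _ hσ (Finset.mem_insert_self _ _)
        · refine ⟨.inr ⟨σ, hσ, rfl⟩, ?_⟩
          rintro (h | ⟨ρ, hρ, h⟩)
          · exact hwI _ (hH₁ h) (Finset.mem_insert_self _ _)
          · have h' := congrArg (Finset.erase · w) h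
            simp only [Finset.erase_insert (hwI _ (hI2 hσ)),
              Finset.erase_insert (hwI _ (hI2 (hH₂ hρ)))] at h'
            exact hn (h' ▸ hρ)
  · push Not at hiso
    refine ⟨∅, Set.empty_subset _, by simp, ?_⟩
    have hcoe : ((A.powerset.filter fun σ => σ ∈ indepSets r A : Finset (Finset α)) :
        Set (Finset α)) = indepSets r A \ ∅ := by
      ext σ
      simp only [Finset.coe_filter, Finset.mem_powerset, Set.sdiff_empty, Set.mem_ofPred_eq]
      exact ⟨fun h => h.2, fun h => ⟨h.1, h⟩⟩
    rw [← hcoe]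
    refine collapsible_of_cone v _ ?_ ?_
    · rw [hcoe, Set.sdiff_empty]
      exact isLowerSet_indepSets r A
    · intro σ hσ
      rw [← Finset.mem_coe, hcoe, Set.sdiff_empty] at hσ ⊢
      refine insert_mem_indepSets hr hv hσ fun a ha hva => ?_
      by_contra hne
      exact hiso a (hσ.1 ha) (Ne.symm hne) hva

end Collapse

/-! ### Realizations of sets of faces -/

section Realize

variable {α : Type*}

/-- The realization, in barycentric coordinates, of a set of faces; an empty face has no points. -/
def realize (S : Set (Finset α)) : Set (α → ℝ) :=
  {x | (∀ a, 0 ≤ x a) ∧ ∃ σ ∈ S, (∀ a, a ∉ σ → x a = 0) ∧ ∑ a ∈ σ, x a = 1}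

theorem realize_mono {S S' : Set (Finset α)} (h : S ⊆ S') : realize S ⊆ realize S' :=
  fun _ ⟨h0, σ, hσ, h1⟩ => ⟨h0, σ, h hσ, h1⟩

theorem sum_eq_one_of_mem_realize [Fintype α] {S : Set (Finset α)} {x : α → ℝ}
    (hx : x ∈ realize S) : ∑ a, x a = 1 := by
  obtain ⟨-, σ, -, h0, h1⟩ := hx
  rw [← h1]
  exact (Finset.sum_subset (Finset.subset_univ σ) fun a _ ha => h0 a ha).symm

theorem mem_realize_of_sum_eq_one [Fintype α] {S : Set (Finset α)} {x : α → ℝ}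
    (hx : ∀ a, 0 ≤ x a) (hsum : ∑ a, x a = 1) {σ : Finset α} (hσ : σ ∈ S)
    (h0 : ∀ a, a ∉ σ → x a = 0) : x ∈ realize S := by
  refine ⟨hx, σ, hσ, h0, ?_⟩
  rw [← hsum]
  exact Finset.sum_subset (Finset.subset_univ σ) fun a _ ha => h0 a ha

/-- The support of a point of the realization of a simplicial complex is a face. -/
theorem support_mem_of_mem_realize [Fintype α] {S : Set (Finset α)} (hS : IsLowerSet S) {x : α → ℝ}
    (hx : x ∈ realize S) : (Finset.univ.filter fun a => x a ≠ 0) ∈ S := by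
  obtain ⟨-, σ, hσ, h0, -⟩ := hx
  refine hS (fun a ha => ?_) hσ
  by_contra h
  exact (Finset.mem_filter.1 ha).2 (h0 a h)

theorem isClosed_realize [Finite α] (S : Set (Finset α)) : IsClosed (realize S) := by
  have : realize S = ⋃ σ ∈ S, {x | (∀ a, 0 ≤ x a) ∧ (∀ a, a ∉ σ → x a = 0) ∧ ∑ a ∈ σ, x a = 1} := by
    ext x
    simp only [realize, Set.mem_iUnion, Set.mem_ofPred_eq, exists_prop]
    exact ⟨fun ⟨h, σ, hσ, h'⟩ => ⟨σ, hσ, h, h'⟩, fun ⟨σ, hσ, h, h'⟩ => ⟨h, σ, hσ, h'⟩⟩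
  rw [this]
  have := Fintype.ofFinite α
  refine S.toFinite.isClosed_biUnion fun σ _ => ?_
  have h1 : IsClosed {x : α → ℝ | ∀ a, 0 ≤ x a} := by
    rw [Set.ofPred_forall]
    exact isClosed_iInter fun a => isClosed_le continuous_const (continuous_apply a)
  have h2 : IsClosed {x : α → ℝ | ∀ a, a ∉ σ → x a = 0} := by
    simp only [Set.ofPred_forall]
    exact isClosed_iInter fun a => isClosed_iInter fun _ =>
      isClosed_eq (continuous_apply a) continuous_const
  have h3 : IsClosed {x : α → ℝ | ∑ a ∈ σ, x a = 1} :=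
    isClosed_eq (continuous_finsetSum _ fun a _ => continuous_apply a) continuous_const
  exact h1.inter (h2.inter h3)

theorem isCompact_realize [Finite α] (S : Set (Finset α)) : IsCompact (realize S) := by
  have := Fintype.ofFinite α
  refine (isCompact_univ_pi fun _ : α => isCompact_Icc (a := (0 : ℝ)) (b := 1)).of_isClosed_subset
    (isClosed_realize S) fun x hx a _ => ⟨hx.1 a, ?_⟩
  rw [← sum_eq_one_of_mem_realize hx]
  exact Finset.single_le_sum (fun b _ => hx.1 b) (Finset.mem_univ a)

/-- The smallest barycentric coordinate on `σ`, or `0` if `σ` is empty. For nonempty `σ`, it is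
positive exactly on the open star of `σ`. -/
def minCoord (σ : Finset α) (x : α → ℝ) : ℝ := if h : σ.Nonempty then σ.inf' h x else 0

theorem continuous_minCoord (σ : Finset α) : Continuous (minCoord σ) := by
  by_cases h : σ.Nonempty
  · have : minCoord σ = fun x => σ.inf' h x := by
      ext x
      simp [minCoord, h]
    rw [this]
    exact Continuous.finset_inf'_apply h fun a _ => continuous_apply a
  · have : minCoord σ = fun _ => 0 := by
      ext x
      simp [minCoord, h]
    rw [this]
    exact continuous_const

theorem minCoord_le {σ : Finset α} {a : α} (ha : a ∈ σ) (x : α → ℝ) : minCoord σ x ≤ x a := by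
  rw [minCoord, dif_pos ⟨a, ha⟩]
  exact Finset.inf'_le _ ha

theorem exists_eq_minCoord {σ : Finset α} (hσ : σ.Nonempty) (x : α → ℝ) :
    ∃ a ∈ σ, x a = minCoord σ x := by
  rw [minCoord, dif_pos hσ]
  obtain ⟨a, ha, h⟩ := Finset.exists_mem_eq_inf' hσ x
  exact ⟨a, ha, h.symm⟩

theorem minCoord_nonneg (σ : Finset α) {x : α → ℝ} (hx : ∀ a, 0 ≤ x a) : 0 ≤ minCoord σ x := by
  by_cases h : σ.Nonempty
  · obtain ⟨a, -, h⟩ := exists_eq_minCoord h x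
    exact h ▸ hx a
  · simp [minCoord, h]

theorem minCoord_pos_iff {σ : Finset α} (hσ : σ.Nonempty) {x : α → ℝ} (hx : ∀ a, 0 ≤ x a) :
    0 < minCoord σ x ↔ ∀ a ∈ σ, x a ≠ 0 := by
  constructor
  · intro h a ha
    exact (h.trans_le (minCoord_le ha x)).ne'
  · intro h
    obtain ⟨a, ha, h'⟩ := exists_eq_minCoord hσ x
    rw [← h']
    exact lt_of_le_of_ne (hx a) (h a ha).symm

theorem minCoord_eq_zero_iff {σ : Finset α} (hσ : σ.Nonempty) {x : α → ℝ} (hx : ∀ a, 0 ≤ x a) :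
    minCoord σ x = 0 ↔ ∃ a ∈ σ, x a = 0 := by
  rw [← not_iff_not, ← ne_eq, ← (minCoord_nonneg σ hx).lt_iff_ne', minCoord_pos_iff hσ hx]
  push Not
  rfl

end Realize

/-! ### Elementary collapses are homotopy equivalences -/

section CollapseHomotopy

variable {α : Type*} [DecidableEq α]

/-- Moving mass from the vertices of `τ` to the vertex `a`. At time `1`, the smallest of the
coordinates on `τ` has become zero. -/
def collapseMap (τ : Finset α) (a : α) (t : ℝ) (x : α → ℝ) : α → ℝ := fun b =>
  x b + t * minCoord τ x * (if b = a then (τ.card : ℝ) else if b ∈ τ then -1 else 0)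

theorem continuous_collapseMap (τ : Finset α) (a : α) :
    Continuous fun p : ℝ × (α → ℝ) => collapseMap τ a p.1 p.2 := by
  refine continuous_pi fun b => ?_
  have := continuous_minCoord τ
  unfold collapseMap
  fun_prop

theorem collapseMap_eq_self {τ : Finset α} (a : α) (t : ℝ) {x : α → ℝ} (h : minCoord τ x = 0) :
    collapseMap τ a t x = x := by
  ext b
  simp [collapseMap, h]

theorem collapseMap_nonneg (τ : Finset α) (a : α) {t : ℝ} (ht0 : 0 ≤ t) (ht1 : t ≤ 1) {x : α → ℝ}
    (hx : ∀ b, 0 ≤ x b) (b : α) : 0 ≤ collapseMap τ a t x b := by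
  have hm := minCoord_nonneg τ hx
  unfold collapseMap
  split_ifs with h1 h2
  · have := hx b
    positivity
  · have h3 := minCoord_le h2 x
    have h4 : t * minCoord τ x ≤ minCoord τ x := mul_le_of_le_one_left hm ht1
    linarith
  · simpa using hx b

theorem sum_collapseMap [Fintype α] {τ : Finset α} {a : α} (ha : a ∉ τ) (t : ℝ) (x : α → ℝ) :
    ∑ b, collapseMap τ a t x b = ∑ b, x b := by
  have h : ∑ b, (if b = a then (τ.card : ℝ) else if b ∈ τ then -1 else 0) = 0 := by
    have : ∀ b, (if b = a then (τ.card : ℝ) else if b ∈ τ then -1 else 0) =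
        (if b = a then (τ.card : ℝ) else 0) - (if b ∈ τ then 1 else 0) := by
      intro b
      by_cases h1 : b = a
      · subst h1
        simp [ha]
      · by_cases h2 : b ∈ τ <;> simp [h1, h2]
    simp_rw [this]
    simp
  unfold collapseMap
  rw [Finset.sum_add_distrib, ← Finset.mul_sum, h]
  simp

theorem collapseMap_mem [Fintype α] {S : Set (Finset α)} (hS : IsLowerSet S)
    {τ : Finset α} (hτ : τ.Nonempty) {a : α} (ha : a ∉ τ) (haS : insert a τ ∈ S)
    (hfree : ∀ ρ ∈ S, τ ⊆ ρ → ρ ⊆ insert a τ)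
    {t : ℝ} (ht0 : 0 ≤ t) (ht1 : t ≤ 1) {x : α → ℝ} (hx : x ∈ realize S) :
    collapseMap τ a t x ∈ realize S := by
  rcases (minCoord_nonneg τ hx.1).eq_or_lt with h | h
  · rwa [collapseMap_eq_self a t h.symm]
  refine mem_realize_of_sum_eq_one (collapseMap_nonneg τ a ht0 ht1 hx.1)
    ((sum_collapseMap ha t x).trans (sum_eq_one_of_mem_realize hx)) haS fun b hb => ?_
  have hsupp := support_mem_of_mem_realize hS hx
  have hle := hfree _ hsupp fun b hb => Finset.mem_filter.2
    ⟨Finset.mem_univ b, (minCoord_pos_iff hτ hx.1).1 h b hb⟩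
  have hxb : x b = 0 := by
    by_contra hne
    exact hb (hle (Finset.mem_filter.2 ⟨Finset.mem_univ b, hne⟩))
  rw [Finset.mem_insert, not_or] at hb
  simp [collapseMap, hxb, hb.1, hb.2]

theorem collapseMap_one_mem [Fintype α] {S : Set (Finset α)} (hS : IsLowerSet S)
    {τ : Finset α} (hτ : τ.Nonempty) {a : α} (ha : a ∉ τ) (haS : insert a τ ∈ S)
    (hfree : ∀ ρ ∈ S, τ ⊆ ρ → ρ ⊆ insert a τ)
    {x : α → ℝ} (hx : x ∈ realize S) :
    collapseMap τ a 1 x ∈ realize {ρ ∈ S | ¬ τ ⊆ ρ} := by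
  have hmem := collapseMap_mem hS hτ ha haS hfree zero_le_one le_rfl hx
  refine mem_realize_of_sum_eq_one hmem.1 (sum_eq_one_of_mem_realize hmem)
    ⟨support_mem_of_mem_realize hS hmem, fun h => ?_⟩ fun b hb => by simpa using hb
  obtain ⟨b, hb, hmin⟩ := exists_eq_minCoord hτ x
  refine (Finset.mem_filter.1 (h hb)).2 ?_
  have : b ≠ a := fun h => ha (h ▸ hb)
  simp [collapseMap, this, hb, hmin]

theorem nonempty_homotopyEquiv_of_collapse [Fintype α] {S : Set (Finset α)} (hS : IsLowerSet S)
    {τ : Finset α} (hτ : τ.Nonempty) {a : α} (ha : a ∉ τ) (haS : insert a τ ∈ S)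
    (hfree : ∀ ρ ∈ S, τ ⊆ ρ → ρ ⊆ insert a τ) :
    Nonempty (ContinuousMap.HomotopyEquiv (realize S) (realize {ρ ∈ S | ¬ τ ⊆ ρ})) := by
  have hsub : realize {ρ ∈ S | ¬ τ ⊆ ρ} ⊆ realize S := realize_mono fun _ h => h.1
  have hzero : ∀ x ∈ realize {ρ ∈ S | ¬ τ ⊆ ρ}, minCoord τ x = 0 := by
    intro x hx
    rw [minCoord_eq_zero_iff hτ hx.1]
    obtain ⟨-, ρ, ⟨-, hρ⟩, h0, -⟩ := hx
    obtain ⟨b, hb, hbρ⟩ := Finset.not_subset.1 hρ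
    exact ⟨b, hb, h0 b hbρ⟩
  have hcont := continuous_collapseMap τ a
  let r : C(realize S, realize {ρ ∈ S | ¬ τ ⊆ ρ}) :=
    ⟨fun x => ⟨collapseMap τ a 1 x.1, collapseMap_one_mem hS hτ ha haS hfree x.2⟩,
      Continuous.subtype_mk (hcont.comp (continuous_const.prodMk continuous_subtype_val)) _⟩
  let i : C(realize {ρ ∈ S | ¬ τ ⊆ ρ}, realize S) := ⟨Set.inclusion hsub, continuous_inclusion hsub⟩
  refine ⟨⟨r, i, ?_, ?_⟩⟩
  · refine ContinuousMap.Homotopic.symm ⟨⟨⟨fun p => ⟨collapseMap τ a p.1 p.2.1,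
      collapseMap_mem hS hτ ha haS hfree p.1.2.1 p.1.2.2 p.2.2⟩, ?_⟩, ?_, ?_⟩⟩
    · exact Continuous.subtype_mk (hcont.comp ((continuous_subtype_val.comp continuous_fst).prodMk
        (continuous_subtype_val.comp continuous_snd))) _
    · intro x
      refine Subtype.ext ?_
      ext b
      simp [collapseMap]
    · intro x
      rfl
  · have : r.comp i = ContinuousMap.id _ := by
      ext1 x
      exact Subtype.ext (collapseMap_eq_self a 1 (hzero x.1 x.2))
    rw [this]

/-- The realization of a nonvoid collapsible complex is contractible. -/
theorem Collapsible.contractibleSpace [Fintype α] {S : Set (Finset α)} (h : Collapsible S)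
    (hS : IsLowerSet S) (hne : S.Nonempty) :
    ContractibleSpace (realize S) := by
  induction h with
  | void => simp at hne
  | step S τ a ha haS hfree h ih =>
    rcases τ.eq_empty_or_nonempty with rfl | hτ
    · have key : ∀ x ∈ realize S, x = Pi.single a 1 := by
        intro x hx
        obtain ⟨h0, σ, hσ, h1, h2⟩ := hx
        have hsub : σ ⊆ {a} := hfree σ hσ (Finset.empty_subset _)
        have hout : ∀ b, b ≠ a → x b = 0 := fun b hb => h1 b fun h => hb (by simpa using hsub h)
        rcases Finset.subset_singleton_iff.1 hsub with rfl | rfl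
        · simp at h2
        · ext b
          by_cases hb : b = a
          · subst hb
            simpa using h2
          · simp [hb, hout b hb]
      have hmem : Pi.single a 1 ∈ realize S := by
        refine ⟨fun b => ?_, {a}, haS, fun b hb => ?_, by simp⟩
        · by_cases hb : b = a
          · subst hb
            simp
          · simp [hb]
        · simp [Finset.notMem_singleton.1 hb]
      have : Nonempty (realize S) := ⟨⟨_, hmem⟩⟩
      have : Subsingleton (realize S) :=
        ⟨fun x y => Subtype.ext ((key x x.2).trans (key y y.2).symm)⟩
      infer_instance
    · have hS' : IsLowerSet {ρ ∈ S | ¬ τ ⊆ ρ} :=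
        fun ρ ρ' hle hρ => ⟨hS hle hρ.1, fun h => hρ.2 (h.trans hle)⟩
      have := ih hS' ⟨∅, hS (Finset.empty_subset _) haS, fun h => hτ.ne_empty
        (Finset.subset_empty.1 h)⟩
      obtain ⟨e⟩ := nonempty_homotopyEquiv_of_collapse hS hτ ha haS hfree
      exact e.contractibleSpace

end CollapseHomotopy

/-! ### Collapsing a contractible subspace -/

section Quotient

variable {X W : Type*} [TopologicalSpace X] [CompactSpace X] [TopologicalSpace W] [T2Space W]

/-- A homotopy that preserves a subspace `Y` descends to the quotient by `Y`. -/
theorem exists_homotopy_of_quotient {Y : Set X} {f : X → W} (hf : Continuous f)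
    (hsurj : Function.Surjective f) (hfib : ∀ x y, f x = f y ↔ x = y ∨ (x ∈ Y ∧ y ∈ Y))
    (G : C(unitInterval × X, X)) (hG : ∀ t, ∀ y ∈ Y, G (t, y) ∈ Y) :
    ∃ G' : C(unitInterval × W, W), ∀ t x, G' (t, f x) = f (G (t, x)) := by
  let p : C(unitInterval × X, unitInterval × W) := ⟨Prod.map id f, continuous_id.prodMap hf⟩
  have hp : Topology.IsQuotientMap p :=
    p.continuous.isClosedMap.isQuotientMap p.continuous (Function.surjective_id.prodMap hsurj)
  let g : C(unitInterval × X, W) := ⟨fun q => f (G q), hf.comp G.continuous⟩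
  have hg : Function.FactorsThrough g p := by
    rintro ⟨t, x⟩ ⟨t', x'⟩ h
    obtain ⟨rfl, h⟩ := Prod.ext_iff.1 h
    rcases (hfib _ _).1 h with rfl | ⟨hx, hx'⟩
    · rfl
    · exact (hfib _ _).2 (.inr ⟨hG _ _ hx, hG _ _ hx'⟩)
  exact ⟨hp.lift g hg, fun t x => DFunLike.congr_fun (hp.lift_comp g hg) (t, x)⟩

/-- The quotient by a contractible closed subspace `Y` is a homotopy equivalence, if a neighbourhood
`{x | m x ≤ c}` of `Y` can be deformed into `Y`. Once it has been deformed, a contraction of `Y` is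
extended to the whole space by slowing it down, up to a standstill where `m x = c`. -/
theorem nonempty_homotopyEquiv_quotient {Y : Set X} [ContractibleSpace Y] {f : X → W}
    (hf : Continuous f) (hsurj : Function.Surjective f)
    (hfib : ∀ x y, f x = f y ↔ x = y ∨ (x ∈ Y ∧ y ∈ Y))
    (D : C(unitInterval × X, X)) (hD0 : ∀ x, D (0, x) = x) (hDY : ∀ t, ∀ y ∈ Y, D (t, y) = y)
    (m : C(X, ℝ)) (hm : ∀ y ∈ Y, m y = 0) {c : ℝ} (hc : 0 < c)
    (hD1 : ∀ x, m x ≤ c → D (1, x) ∈ Y) :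
    Nonempty (ContinuousMap.HomotopyEquiv X W) := by
  obtain ⟨y₀, ⟨K⟩⟩ := id_nullhomotopic Y
  let s : unitInterval × X → unitInterval := fun p =>
    p.1 * Set.projIcc 0 1 zero_le_one (1 - m p.2 / c)
  have hs : Continuous s := by
    refine continuous_fst.mul (continuous_projIcc.comp ?_)
    fun_prop
  classical
  -- the second stage of the homotopy: `D (1, x)` follows the contraction `K` up to time `s (t, x)`
  let C : unitInterval × X → X := fun p =>
    if h : m p.2 ≤ c then K (s p, ⟨D (1, p.2), hD1 _ h⟩) else D (1, p.2)
  have hC_of_le : ∀ p (h : m p.2 ≤ c), C p = K (s p, ⟨D (1, p.2), hD1 _ h⟩) :=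
    fun p h => dif_pos h
  have hs0 : ∀ p : unitInterval × X, c ≤ m p.2 → s p = 0 := by
    intro p h
    have : (1 : ℝ) - m p.2 / c ≤ 0 := by
      rw [sub_nonpos, one_le_div hc]
      exact h
    simp only [s]
    rw [Set.projIcc_of_le_left _ this]
    exact mul_zero _
  have hC_of_ge : ∀ p, c ≤ m p.2 → C p = D (1, p.2) := by
    intro p h
    by_cases h' : m p.2 ≤ c
    · rw [hC_of_le p h', hs0 p h, K.apply_zero]
      rfl
    · exact dif_neg h'
  have hC : Continuous C := by
    have hA : IsClosed {p : unitInterval × X | m p.2 ≤ c} :=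
      isClosed_le (m.continuous.comp continuous_snd) continuous_const
    have hB : IsClosed {p : unitInterval × X | c ≤ m p.2} :=
      isClosed_le continuous_const (m.continuous.comp continuous_snd)
    rw [← continuousOn_univ]
    have huniv : (Set.univ : Set (unitInterval × X)) = {p | m p.2 ≤ c} ∪ {p | c ≤ m p.2} := by
      ext p
      simpa using le_total (m p.2) c
    rw [huniv]
    refine ContinuousOn.union_of_isClosed ?_ ?_ hA hB
    · rw [continuousOn_iff_continuous_domRestrict]
      have : Set.domRestrict {p : unitInterval × X | m p.2 ≤ c} C =
          fun p => (K (s p.1, ⟨D (1, p.1.2), hD1 _ p.2⟩)).1 := by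
        ext1 p
        exact hC_of_le p.1 p.2
      rw [this]
      refine continuous_subtype_val.comp (K.continuous.comp
        ((hs.comp continuous_subtype_val).prodMk (Continuous.subtype_mk ?_ _)))
      exact D.continuous.comp (continuous_const.prodMk
        (continuous_snd.comp continuous_subtype_val))
    · refine ContinuousOn.congr (f := fun p : unitInterval × X => D (1, p.2)) ?_
        fun p hp => hC_of_ge p hp
      exact (D.continuous.comp (continuous_const.prodMk continuous_snd)).continuousOn
  have hC0 : ∀ x, C (0, x) = D (1, x) := by
    intro x
    by_cases h : m x ≤ c
    · rw [hC_of_le (0, x) h]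
      have : s (0, x) = 0 := zero_mul _
      rw [this, K.apply_zero]
      rfl
    · exact dif_neg h
  have hmY : ∀ y ∈ Y, m y ≤ c := fun y hy => (hm y hy).trans_le hc.le
  have hCY : ∀ t, ∀ y ∈ Y, C (t, y) ∈ Y := by
    intro t y hy
    rw [hC_of_le (t, y) (hmY y hy)]
    exact Subtype.coe_prop _
  have hC1 : ∀ y ∈ Y, C (1, y) = y₀ := by
    intro y hy
    rw [hC_of_le (1, y) (hmY y hy)]
    have : s (1, y) = 1 := by
      simp only [s, hm y hy, zero_div, sub_zero]
      rw [Set.projIcc_right]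
      exact mul_one _
    rw [this, K.apply_one]
    rfl
  -- both stages preserve `Y`, so that they descend to `W`; the end `C₁` of the second stage is
  -- constant on `Y`, so that it factors through a map `g` from `W` to `X`
  obtain ⟨D', hD'⟩ := exists_homotopy_of_quotient hf hsurj hfib D
    (fun t y hy => by rw [hDY t y hy]; exact hy)
  obtain ⟨C', hC'⟩ := exists_homotopy_of_quotient hf hsurj hfib ⟨C, hC⟩ hCY
  let F : C(X, W) := ⟨f, hf⟩
  have hF : Topology.IsQuotientMap F := hf.isClosedMap.isQuotientMap hf hsurj
  let C₁ : C(X, X) := ⟨fun x => C (1, x), hC.comp (continuous_const.prodMk continuous_id)⟩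
  let D₁ : C(X, X) := ⟨fun x => D (1, x), D.continuous.comp (continuous_const.prodMk continuous_id)⟩
  let D₁' : C(W, W) :=
    ⟨fun x => D' (1, x), D'.continuous.comp (continuous_const.prodMk continuous_id)⟩
  have hlift : ∀ x y, F x = F y → C₁ x = C₁ y := by
    intro x y h
    rcases (hfib x y).1 h with rfl | ⟨hx, hy⟩
    · rfl
    · exact (hC1 x hx).trans (hC1 y hy).symm
  let g : C(W, X) := hF.lift C₁ hlift
  have hg : g.comp F = C₁ := hF.lift_comp C₁ hlift
  refine ⟨⟨F, g, ?_, ?_⟩⟩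
  · rw [hg]
    have h1 : (ContinuousMap.id X).Homotopic D₁ := ⟨⟨D, hD0, fun x => rfl⟩⟩
    have h2 : D₁.Homotopic C₁ := ⟨⟨⟨C, hC⟩, hC0, fun x => rfl⟩⟩
    exact (h1.trans h2).symm
  · have h1 : (ContinuousMap.id W).Homotopic D₁' := by
      refine ⟨⟨D', fun w => ?_, fun w => rfl⟩⟩
      obtain ⟨x, rfl⟩ := hsurj w
      exact (hD' 0 x).trans (congrArg f (hD0 x))
    have h2 : D₁'.Homotopic (F.comp g) := by
      refine ⟨⟨C', fun w => ?_, fun w => ?_⟩⟩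
      · obtain ⟨x, rfl⟩ := hsurj w
        exact ((hC' 0 x).trans (congrArg f (hC0 x))).trans (hD' 1 x).symm
      · obtain ⟨x, rfl⟩ := hsurj w
        exact (hC' 1 x).trans (congrArg f (DFunLike.congr_fun hg x).symm)
    exact (h1.trans h2).symm

end Quotient

/-! ### Wedges of spheres as subspaces of products -/

section Wedge

variable {ι : Type*} (d : ι → ℕ)

/-- The embedding of a wedge of spheres into the product of the spheres. -/
def wedgeToProd [DecidableEq ι] : WedgeOfSpheres d → ∀ i, Sphere (d i) :=
  Quotient.lift (fun x => Function.update (fun i => Sphere.base (d i)) x.1 x.2) (by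
    rintro x y (rfl | ⟨hx, hy⟩)
    · rfl
    · simp only [hx, hy, Function.update_eq_self])

theorem wedgeToProd_mk [DecidableEq ι] (x : Σ i, Sphere (d i)) :
    wedgeToProd d (Quotient.mk _ x) = Function.update (fun i => Sphere.base (d i)) x.1 x.2 := rfl

theorem continuous_wedgeToProd [DecidableEq ι] : Continuous (wedgeToProd d) := by
  refine Continuous.quotient_lift (continuous_sigma fun i => ?_) _
  exact continuous_const.update i continuous_id

theorem wedgeToProd_injective [DecidableEq ι] : Function.Injective (wedgeToProd d) := by
  intro x y
  induction x using Quotient.ind with | _ x =>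
  induction y using Quotient.ind with | _ y =>
  obtain ⟨i, x⟩ := x
  obtain ⟨j, y⟩ := y
  intro h
  rw [wedgeToProd_mk, wedgeToProd_mk] at h
  refine Quotient.sound ?_
  by_cases hij : i = j
  · subst hij
    exact .inl (congrArg _ (Function.update_injective _ i h))
  · refine .inr ⟨?_, ?_⟩
    · have := congrFun h i
      simpa [Function.update_of_ne hij] using this
    · have := congrFun h j
      simpa [Function.update_of_ne (Ne.symm hij)] using this.symm

instance : T2Space (WedgeOfSpheres d) := by
  classical
  exact T2Space.of_injective_continuous (wedgeToProd_injective d) (continuous_wedgeToProd d)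

theorem isEmbedding_wedgeToProd [DecidableEq ι] [Finite ι] : Topology.IsEmbedding (wedgeToProd d) :=
  ((continuous_wedgeToProd d).isClosedEmbedding (wedgeToProd_injective d)).isEmbedding

end Wedge

/-! ### Open simplices and spheres -/

/-- The map from a compact space to the one-point compactification of an open subset that collapses
the complement of the subset is continuous. -/
theorem continuous_collapse_onePoint {X : Type*} [TopologicalSpace X] [T2Space X] {U : Set X}
    [DecidablePred (· ∈ U)] (hU : IsOpen U) :
    Continuous fun x => if h : x ∈ U then ((⟨x, h⟩ : U) : OnePoint U) else OnePoint.infty := by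
  rw [continuous_def]
  intro s hs
  by_cases h : OnePoint.infty ∈ s
  · rw [OnePoint.isOpen_iff_of_mem h] at hs
    have : ((fun x => if h : x ∈ U then ((⟨x, h⟩ : U) : OnePoint U) else OnePoint.infty) ⁻¹' s)ᶜ =
        Subtype.val '' (((↑) ⁻¹' s : Set U)ᶜ) := by
      ext x
      by_cases hx : x ∈ U
      · simp [hx]
      · simp [hx, h]
    rw [← isClosed_compl_iff, this]
    exact (hs.2.image continuous_subtype_val).isClosed
  · rw [OnePoint.isOpen_iff_of_notMem h] at hs
    convert hU.isOpenMap_subtype_val _ hs using 1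
    ext x
    by_cases hx : x ∈ U
    · simp [hx]
    · simp [hx, h]

/-- The one-point compactification of a vector space of dimension `d` is the `d`-sphere, with the
point at infinity as base point. -/
theorem exists_onePoint_homeomorph_sphere {κ : Type*} [Fintype κ] (d : ℕ)
    (h : Fintype.card κ = d) :
    ∃ φ : OnePoint (κ → ℝ) ≃ₜ Sphere d, φ OnePoint.infty = Sphere.base d := by
  let φ : OnePoint (κ → ℝ) ≃ₜ Sphere d := onePointEquivSphereOfFinrankEq (by simp [h])
  let p : EuclideanSpace ℝ (Fin (d + 1)) := (φ OnePoint.infty).1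
  let b : EuclideanSpace ℝ (Fin (d + 1)) := (Sphere.base d).1
  have hp : ‖p‖ = 1 := mem_sphere_zero_iff_norm.1 (φ OnePoint.infty).2
  have hb : ‖b‖ = 1 := mem_sphere_zero_iff_norm.1 (Sphere.base d).2
  -- the reflection in the hyperplane orthogonal to `p - b` exchanges `p` and `b`
  let r := Submodule.reflection (Submodule.span ℝ {p - b})ᗮ
  have hr : r p = b := Submodule.reflection_sub (hp.trans hb.symm)
  have hr' : ∀ x, x ∈ Metric.sphere (0 : EuclideanSpace ℝ (Fin (d + 1))) 1 ↔
      r x ∈ Metric.sphere (0 : EuclideanSpace ℝ (Fin (d + 1))) 1 := by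
    intro x
    simp
  exact ⟨φ.trans (r.toHomeomorph.subtype hr'), Subtype.ext hr⟩

section OpenSimplex

variable {α : Type*}

/-- A point of the realization in the open star of a facet is in the interior of this facet. -/
theorem eq_zero_of_minCoord_pos [Fintype α] {S : Set (Finset α)} (hS : IsLowerSet S)
    {σ : Finset α} (hσ : σ.Nonempty) (hmax : ∀ ρ ∈ S, σ ⊆ ρ → ρ = σ) {x : α → ℝ}
    (hx : x ∈ realize S) (h : 0 < minCoord σ x) {b : α} (hb : b ∉ σ) : x b = 0 := by
  have hsupp := hmax _ (support_mem_of_mem_realize hS hx) fun b hb => Finset.mem_filter.2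
    ⟨Finset.mem_univ b, (minCoord_pos_iff hσ hx.1).1 h b hb⟩
  by_contra hne
  rw [← hsupp] at hb
  exact hb (Finset.mem_filter.2 ⟨Finset.mem_univ b, hne⟩)

/-- The coordinates, up to a common factor, of the point of the open simplex on `σ` where the
logarithms of the ratios of the coordinates to the coordinate at `a` are `v`. -/
def expCoord [DecidableEq α] (σ : Finset α) (a : α) (v : σ.erase a → ℝ) (b : α) : ℝ :=
  if h : b ∈ σ.erase a then Real.exp (v ⟨b, h⟩) else if b = a then 1 else 0

theorem expCoord_nonneg [DecidableEq α] (σ : Finset α) (a : α) (v : σ.erase a → ℝ) (b : α) :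
    0 ≤ expCoord σ a v b := by
  unfold expCoord
  split_ifs <;> positivity

theorem expCoord_self [DecidableEq α] (σ : Finset α) (a : α) (v : σ.erase a → ℝ) :
    expCoord σ a v a = 1 := by
  simp [expCoord]

theorem expCoord_pos [DecidableEq α] {σ : Finset α} (a : α) (v : σ.erase a → ℝ) {b : α}
    (hb : b ∈ σ) :
    0 < expCoord σ a v b := by
  by_cases h : b = a
  · subst h
    simp [expCoord_self]
  · have : b ∈ σ.erase a := Finset.mem_erase.2 ⟨h, hb⟩
    rw [expCoord, dif_pos this]
    exact Real.exp_pos _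

theorem expCoord_of_notMem [DecidableEq α] {σ : Finset α} {a : α} (ha : a ∈ σ)
    (v : σ.erase a → ℝ) {b : α} (hb : b ∉ σ) : expCoord σ a v b = 0 := by
  have h1 : b ∉ σ.erase a := fun h => hb (Finset.mem_of_mem_erase h)
  have h2 : b ≠ a := fun h => hb (h ▸ ha)
  simp [expCoord, h1, h2]

theorem continuous_expCoord [DecidableEq α] (σ : Finset α) (a : α) : Continuous (expCoord σ a) := by
  refine continuous_pi fun b => ?_
  unfold expCoord
  split_ifs
  · exact Real.continuous_exp.comp (continuous_apply _)
  · exact continuous_const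
  · exact continuous_const

theorem sum_expCoord_pos [Fintype α] [DecidableEq α] (σ : Finset α) (a : α) (v : σ.erase a → ℝ) :
    0 < ∑ b, expCoord σ a v b :=
  Finset.sum_pos' (fun b _ => expCoord_nonneg σ a v b)
    ⟨a, Finset.mem_univ a, by simp [expCoord_self]⟩

/-- The open simplex on a facet is homeomorphic to a vector space. -/
def openSimplexHomeomorph [Fintype α] [DecidableEq α] {S : Set (Finset α)} (hS : IsLowerSet S)
    {σ : Finset α} (hσS : σ ∈ S) (hmax : ∀ ρ ∈ S, σ ⊆ ρ → ρ = σ) {a : α} (ha : a ∈ σ) :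
    {x : realize S | 0 < minCoord σ x.1} ≃ₜ (σ.erase a → ℝ) where
  toFun x b := Real.log (x.1.1 b) - Real.log (x.1.1 a)
  invFun v := by
    have hmem : (fun b => expCoord σ a v b / ∑ c, expCoord σ a v c) ∈ realize S := by
      refine mem_realize_of_sum_eq_one
        (fun b => div_nonneg (expCoord_nonneg σ a v b) (sum_expCoord_pos σ a v).le) ?_ hσS
        fun b hb => by rw [expCoord_of_notMem ha v hb, zero_div]
      rw [← Finset.sum_div]
      exact div_self (sum_expCoord_pos σ a v).ne'
    exact ⟨⟨_, hmem⟩, (minCoord_pos_iff ⟨a, ha⟩ hmem.1).2 fun b hb =>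
      (div_pos (expCoord_pos a v hb) (sum_expCoord_pos σ a v)).ne'⟩
  left_inv x := by
    obtain ⟨⟨x, hx⟩, hpos⟩ := x
    have hne := (minCoord_pos_iff ⟨a, ha⟩ hx.1).1 hpos
    have hpos' : ∀ b ∈ σ, 0 < x b := fun b hb => lt_of_le_of_ne (hx.1 b) (hne b hb).symm
    have key : ∀ b, expCoord σ a (fun b => Real.log (x b) - Real.log (x a)) b = x b / x a := by
      intro b
      by_cases hb : b ∈ σ
      · by_cases hba : b = a
        · subst hba
          rw [expCoord_self, div_self (hne b hb)]
        · rw [expCoord, dif_pos (Finset.mem_erase.2 ⟨hba, hb⟩), Real.exp_sub,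
            Real.exp_log (hpos' b hb), Real.exp_log (hpos' a ha)]
      · rw [expCoord_of_notMem ha _ hb,
          eq_zero_of_minCoord_pos hS ⟨a, ha⟩ hmax hx hpos hb, zero_div]
    refine Subtype.ext (Subtype.ext (funext fun b => ?_))
    simp only [key]
    rw [← Finset.sum_div, sum_eq_one_of_mem_realize hx]
    field_simp [hne a ha]
  right_inv v := by
    ext b
    have h1 := sum_expCoord_pos σ a v
    have h2 := expCoord_pos a v (Finset.mem_of_mem_erase b.2)
    simp only
    rw [Real.log_div h2.ne' h1.ne', expCoord_self, Real.log_div one_ne_zero h1.ne', Real.log_one,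
      expCoord, dif_pos b.2, Real.log_exp]
    ring
  continuous_toFun := by
    have hne : ∀ x : {x : realize S | 0 < minCoord σ x.1}, ∀ b ∈ σ, x.1.1 b ≠ 0 :=
      fun x => (minCoord_pos_iff ⟨a, ha⟩ x.1.2.1).1 x.2
    have hc : ∀ b, Continuous fun x : {x : realize S | 0 < minCoord σ x.1} => x.1.1 b := fun b =>
      (continuous_apply b).comp (continuous_subtype_val.comp continuous_subtype_val)
    exact continuous_pi fun b => ((hc b).log fun x => hne x b (Finset.mem_of_mem_erase b.2)).sub
      ((hc a).log fun x => hne x a ha)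
  continuous_invFun := by
    have hc : ∀ b, Continuous fun v => expCoord σ a v b := fun b =>
      (continuous_apply b).comp (continuous_expCoord σ a)
    exact Continuous.subtype_mk (Continuous.subtype_mk (continuous_pi fun b =>
      (hc b).div (continuous_finsetSum _ fun c _ => hc c)
        fun v => (sum_expCoord_pos σ a v).ne') _) _

/-- A facet gives a map to a sphere that sends the complement of the open facet to the base point
and is a bijection from the open facet to the complement of the base point. -/
theorem exists_map_to_sphere [Fintype α] {S : Set (Finset α)} (hS : IsLowerSet S)
    {σ : Finset α} (hσ : σ.Nonempty) (hσS : σ ∈ S) (hmax : ∀ ρ ∈ S, σ ⊆ ρ → ρ = σ) :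
    ∃ q : realize S → Sphere (σ.card - 1), Continuous q ∧
      (∀ x, q x = Sphere.base _ ↔ minCoord σ x.1 = 0) ∧
      (∀ x y, 0 < minCoord σ x.1 → q x = q y → x = y) ∧
      ∀ z ≠ Sphere.base _, ∃ x, q x = z := by
  classical
  obtain ⟨a, ha⟩ := hσ
  let U : Set (realize S) := {x | 0 < minCoord σ x.1}
  have hU : IsOpen U :=
    isOpen_lt continuous_const ((continuous_minCoord σ).comp continuous_subtype_val)
  obtain ⟨φ, hφ⟩ := exists_onePoint_homeomorph_sphere (κ := σ.erase a) (σ.card - 1)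
    (by rw [Fintype.card_coe, Finset.card_erase_of_mem ha])
  let ψ : OnePoint U ≃ₜ Sphere (σ.card - 1) :=
    (openSimplexHomeomorph hS hσS hmax ha).onePointCongr.trans φ
  have hψ : ψ OnePoint.infty = Sphere.base _ := hφ
  let c : realize S → OnePoint U := fun x =>
    if h : x ∈ U then ((⟨x, h⟩ : U) : OnePoint U) else OnePoint.infty
  have hcpos : ∀ x (h : x ∈ U), c x = ((⟨x, h⟩ : U) : OnePoint U) := fun x h => dif_pos h
  have hcneg : ∀ x ∉ U, c x = OnePoint.infty := fun x h => dif_neg h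
  refine ⟨fun x => ψ (c x), ψ.continuous.comp (continuous_collapse_onePoint hU), ?_, ?_, ?_⟩
  · intro x
    rw [← hψ, ψ.injective.eq_iff]
    by_cases h : x ∈ U
    · rw [hcpos x h]
      exact iff_of_false (OnePoint.coe_ne_infty _) (ne_of_gt h)
    · rw [hcneg x h]
      exact iff_of_true rfl (le_antisymm (not_lt.1 h) (minCoord_nonneg σ x.2.1))
  · intro x y hx h
    have h' := ψ.injective h
    rw [hcpos x hx] at h'
    by_cases hy : y ∈ U
    · rw [hcpos y hy] at h'
      exact congrArg Subtype.val (OnePoint.coe_injective h')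
    · rw [hcneg y hy] at h'
      exact absurd h' (OnePoint.coe_ne_infty _)
  · intro z hz
    obtain ⟨w, rfl⟩ := ψ.surjective z
    induction w using OnePoint.rec with
    | infty => exact absurd hψ hz
    | coe u => exact ⟨u.1, congrArg ψ (hcpos u.1 u.2)⟩

end OpenSimplex

/-! ### Complexes that become contractible without some facets -/

section FacetFamily

variable {α ι : Type*}

/-- `σ` is a family of distinct nonempty facets of the simplicial complex `S`. -/
structure IsFacetFamily (S : Set (Finset α)) (σ : ι → Finset α) : Prop where
  isLowerSet : IsLowerSet S
  injective : Function.Injective σ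
  nonempty : ∀ i, (σ i).Nonempty
  mem : ∀ i, σ i ∈ S
  maximal : ∀ i, ∀ ρ ∈ S, σ i ⊆ ρ → ρ = σ i

namespace IsFacetFamily

variable {S : Set (Finset α)} {σ : ι → Finset α}

theorem eq_of_subset (h : IsFacetFamily S σ) {i j : ι} (hij : σ i ⊆ σ j) : i = j :=
  h.injective (h.maximal i _ (h.mem j) hij).symm

theorem eq_zero_of_pos [Fintype α] (h : IsFacetFamily S σ) {x : α → ℝ} (hx : x ∈ realize S) {i : ι}
    (hi : 0 < minCoord (σ i) x) {b : α} (hb : b ∉ σ i) : x b = 0 :=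
  eq_zero_of_minCoord_pos h.isLowerSet (h.nonempty i) (h.maximal i) hx hi hb

/-- A point is in the interior of at most one facet of the family. -/
theorem minCoord_eq_zero_of_pos [Fintype α] (h : IsFacetFamily S σ) {x : α → ℝ}
    (hx : x ∈ realize S) {i j : ι} (hi : 0 < minCoord (σ i) x) (hij : j ≠ i) :
    minCoord (σ j) x = 0 := by
  by_contra hne
  have hj := lt_of_le_of_ne (minCoord_nonneg (σ j) hx.1) (Ne.symm hne)
  refine hij (h.eq_of_subset fun b hb => ?_)
  by_contra hbi
  exact (minCoord_pos_iff (h.nonempty j) hx.1).1 hj b hb (h.eq_zero_of_pos hx hi hbi)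

theorem mem_realize_diff_iff [Fintype α] (h : IsFacetFamily S σ) {x : α → ℝ} (hx : x ∈ realize S) :
    x ∈ realize (S \ Set.range σ) ↔ ∀ i, minCoord (σ i) x = 0 := by
  constructor
  · rintro ⟨-, ρ, ⟨hρ, hρσ⟩, h0, -⟩ i
    rw [minCoord_eq_zero_iff (h.nonempty i) hx.1]
    by_contra! hne
    refine hρσ ⟨i, (h.maximal i ρ hρ fun b hb => ?_).symm⟩
    by_contra hbρ
    exact hne b hb (h0 b hbρ)
  · intro h0
    refine mem_realize_of_sum_eq_one hx.1 (sum_eq_one_of_mem_realize hx)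
      ⟨support_mem_of_mem_realize h.isLowerSet hx, ?_⟩ fun b hb => by simpa using hb
    rintro ⟨i, hi⟩
    obtain ⟨b, hb, hxb⟩ := (minCoord_eq_zero_iff (h.nonempty i) hx.1).1 (h0 i)
    rw [hi] at hb
    exact (Finset.mem_filter.1 hb).2 hxb

end IsFacetFamily

/-- Pushing the points of the interiors of the facets `σ i` away from the barycenters: one subtracts
from the coordinates a common number, at time `1` the smallest coordinate or `c`, and normalizes. -/
def pushOff [DecidableEq α] [Fintype ι] (σ : ι → Finset α) (c t : ℝ) (x : α → ℝ) : α → ℝ := fun b =>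
  (x b - t * ∑ i, if b ∈ σ i then min (minCoord (σ i) x) c else 0) /
    (1 - t * ∑ i, (σ i).card * min (minCoord (σ i) x) c)

variable {S : Set (Finset α)} {σ : ι → Finset α} {c : ℝ}

theorem pushOff_zero [DecidableEq α] [Fintype ι] (σ : ι → Finset α) (c : ℝ) (x : α → ℝ) :
    pushOff σ c 0 x = x := by
  ext b
  simp [pushOff]

theorem pushOff_eq_self [DecidableEq α] [Fintype ι] (hc : 0 ≤ c) (t : ℝ) {x : α → ℝ}
    (hx : ∀ i, minCoord (σ i) x = 0) :
    pushOff σ c t x = x := by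
  ext b
  simp [pushOff, hx, hc]

namespace IsFacetFamily

theorem pushOff_of_pos [Fintype α] [DecidableEq α] [Fintype ι] (h : IsFacetFamily S σ)
    (hc : 0 ≤ c) (t : ℝ) {x : α → ℝ} (hx : x ∈ realize S) {i : ι}
    (hi : 0 < minCoord (σ i) x) (b : α) :
    pushOff σ c t x b = (x b - t * if b ∈ σ i then min (minCoord (σ i) x) c else 0) /
      (1 - t * ((σ i).card * min (minCoord (σ i) x) c)) := by
  have h0 : ∀ j, j ≠ i → min (minCoord (σ j) x) c = 0 := fun j hj => by
    rw [h.minCoord_eq_zero_of_pos hx hi hj, min_eq_left hc]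
  unfold pushOff
  rw [Finset.sum_eq_single i (fun j _ hj => by rw [h0 j hj, ite_self]) (by simp),
    Finset.sum_eq_single i (fun j _ hj => by rw [h0 j hj, mul_zero]) (by simp)]

/-- The normalizing factor does not vanish if `c` is small. -/
theorem pushOff_denom_pos [Fintype α] [Fintype ι] (h : IsFacetFamily S σ) (hc : 0 ≤ c)
    (hcard : Fintype.card α * c < 1) {t : ℝ} (ht1 : t ≤ 1) {x : α → ℝ} (hx : x ∈ realize S) :
    0 < 1 - t * ∑ i, (σ i).card * min (minCoord (σ i) x) c := by
  have hle : ∑ i, (σ i).card * min (minCoord (σ i) x) c ≤ Fintype.card α * c := by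
    by_cases hpos : ∃ i, 0 < minCoord (σ i) x
    · obtain ⟨i, hi⟩ := hpos
      rw [Finset.sum_eq_single i (fun j _ hj => by
        rw [h.minCoord_eq_zero_of_pos hx hi hj, min_eq_left hc, mul_zero]) (by simp)]
      have h1 : ((σ i).card : ℝ) ≤ Fintype.card α := by exact_mod_cast Finset.card_le_univ _
      exact mul_le_mul h1 (min_le_right _ _) (le_min hi.le hc) (by positivity)
    · push Not at hpos
      rw [Finset.sum_eq_zero fun i _ => by
        rw [le_antisymm (hpos i) (minCoord_nonneg _ hx.1), min_eq_left hc, mul_zero]]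
      positivity
  have h2 : t * ∑ i, (σ i).card * min (minCoord (σ i) x) c ≤ 1 * (Fintype.card α * c) :=
    mul_le_mul ht1 hle (Finset.sum_nonneg fun i _ => mul_nonneg (by positivity)
      (le_min (minCoord_nonneg _ hx.1) hc)) zero_le_one
  linarith

theorem pushOff_mem [Fintype α] [DecidableEq α] [Fintype ι] (h : IsFacetFamily S σ)
    (hc : 0 ≤ c) (hcard : Fintype.card α * c < 1)
    {t : ℝ} (ht1 : t ≤ 1) {x : α → ℝ} (hx : x ∈ realize S) :
    pushOff σ c t x ∈ realize S := by
  by_cases hpos : ∃ i, 0 < minCoord (σ i) x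
  swap
  · push Not at hpos
    rwa [pushOff_eq_self hc t fun i => le_antisymm (hpos i) (minCoord_nonneg _ hx.1)]
  obtain ⟨i, hi⟩ := hpos
  have hden := h.pushOff_denom_pos hc hcard ht1 hx
  have hm : 0 ≤ min (minCoord (σ i) x) c := le_min hi.le hc
  refine mem_realize_of_sum_eq_one (σ := σ i) (fun b => ?_) ?_ (h.mem i) fun b hb => ?_
  · refine div_nonneg ?_ hden.le
    have hnum : ∑ j, (if b ∈ σ j then min (minCoord (σ j) x) c else 0) =
        if b ∈ σ i then min (minCoord (σ i) x) c else 0 :=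
      Finset.sum_eq_single i (fun j _ hj => by
        rw [h.minCoord_eq_zero_of_pos hx hi hj, min_eq_left hc, ite_self]) (by simp)
    rw [hnum]
    split_ifs with hb
    · have h1 := minCoord_le hb x
      have h2 : t * min (minCoord (σ i) x) c ≤ min (minCoord (σ i) x) c :=
        mul_le_of_le_one_left hm ht1
      have h3 := min_le_left (minCoord (σ i) x) c
      linarith
    · simpa using hx.1 b
  · have hden' : 1 - t * ((σ i).card * min (minCoord (σ i) x) c) ≠ 0 := by
      rw [Finset.sum_eq_single i (fun j _ hj => by
        rw [h.minCoord_eq_zero_of_pos hx hi hj, min_eq_left hc, mul_zero]) (by simp)] at hden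
      exact hden.ne'
    simp_rw [h.pushOff_of_pos hc t hx hi]
    rw [← Finset.sum_div, Finset.sum_sub_distrib, sum_eq_one_of_mem_realize hx, ← Finset.mul_sum]
    simpa using div_self hden'
  · rw [h.pushOff_of_pos hc t hx hi, if_neg hb, h.eq_zero_of_pos hx hi hb]
    simp

theorem pushOff_one_mem [Fintype α] [DecidableEq α] [Fintype ι] (h : IsFacetFamily S σ)
    (hc : 0 ≤ c) (hcard : Fintype.card α * c < 1)
    {x : α → ℝ} (hx : x ∈ realize S) (hle : ∀ i, minCoord (σ i) x ≤ c) :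
    pushOff σ c 1 x ∈ realize (S \ Set.range σ) := by
  have hmem := h.pushOff_mem hc hcard le_rfl hx
  rw [h.mem_realize_diff_iff hmem]
  by_cases hpos : ∃ i, 0 < minCoord (σ i) x
  swap
  · push Not at hpos
    have h0 := fun i => le_antisymm (hpos i) (minCoord_nonneg _ hx.1)
    rwa [pushOff_eq_self hc 1 h0]
  obtain ⟨i, hi⟩ := hpos
  intro j
  rw [minCoord_eq_zero_iff (h.nonempty j) hmem.1]
  by_cases hji : j = i
  · subst hji
    obtain ⟨b, hb, hmin⟩ := exists_eq_minCoord (h.nonempty j) x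
    exact ⟨b, hb, by simp [h.pushOff_of_pos hc 1 hx hi, hb, hmin, hle j]⟩
  · obtain ⟨b, hb, hbi⟩ := Finset.not_subset.1 fun hs => hji (h.eq_of_subset hs)
    exact ⟨b, hb, by
      rw [h.pushOff_of_pos hc 1 hx hi, if_neg hbi, h.eq_zero_of_pos hx hi hbi]
      simp⟩

/-- A simplicial complex which becomes contractible when some facets are removed is homotopy
equivalent to a wedge of spheres, with one sphere for each of these facets. -/
theorem nonempty_homotopyEquiv_wedge [Fintype α] [Fintype ι] [Nonempty ι]
    (h : IsFacetFamily S σ)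
    [ContractibleSpace (realize (S \ Set.range σ))] :
    Nonempty (ContinuousMap.HomotopyEquiv (realize S)
      (WedgeOfSpheres fun i => (σ i).card - 1)) := by
  classical
  choose q hq hbase hinj hsurj using fun i =>
    exists_map_to_sphere h.isLowerSet (h.nonempty i) (h.mem i) (h.maximal i)
  let d : ι → ℕ := fun i => (σ i).card - 1
  have : CompactSpace (realize S) := isCompact_iff_compactSpace.1 (isCompact_realize S)
  let Y : Set (realize S) := {x | ∀ i, minCoord (σ i) x.1 = 0}
  have hsub : realize (S \ Set.range σ) ⊆ realize S := realize_mono Set.sdiff_subset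
  have hYeq : ∀ x : realize S, x.1 ∈ realize (S \ Set.range σ) ↔ x ∈ Y := fun x =>
    h.mem_realize_diff_iff x.2
  have : ContractibleSpace Y := by
    let e : Y ≃ₜ realize (S \ Set.range σ) :=
      { toFun := fun y => ⟨y.1.1, (hYeq y.1).2 y.2⟩
        invFun := fun y => ⟨⟨y.1, hsub y.2⟩, (hYeq ⟨y.1, hsub y.2⟩).1 y.2⟩
        left_inv := fun y => rfl
        right_inv := fun y => rfl
        continuous_toFun := Continuous.subtype_mk
          (continuous_subtype_val.comp continuous_subtype_val) _
        continuous_invFun := Continuous.subtype_mk (Continuous.subtype_mk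
          continuous_subtype_val _) _ }
    exact e.contractibleSpace
  obtain ⟨y₀⟩ : Nonempty Y := inferInstance
  have hpos : ∀ x : realize S, x ∉ Y → ∃ i, 0 < minCoord (σ i) x.1 := by
    intro x hx
    obtain ⟨i, hi⟩ := not_forall.1 hx
    exact ⟨i, lt_of_le_of_ne (minCoord_nonneg _ x.2.1) (Ne.symm hi)⟩
  have hqY : ∀ x ∈ Y, (fun i => q i x) = fun i => Sphere.base (d i) := fun x hx =>
    funext fun i => (hbase i x).2 (hx i)
  have hqpos : ∀ x i, 0 < minCoord (σ i) x.1 →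
      (fun j => q j x) = Function.update (fun j => Sphere.base (d j)) i (q i x) := by
    intro x i hi
    rw [Function.eq_update_iff]
    exact ⟨rfl, fun j hj => (hbase j x).2 (h.minCoord_eq_zero_of_pos x.2 hi hj)⟩
  -- the wedge is regarded as a subspace of the product of the spheres
  have hf : ∀ x, ∃ w : WedgeOfSpheres d, wedgeToProd d w = fun i => q i x := by
    intro x
    by_cases hx : x ∈ Y
    · let i : ι := Classical.arbitrary ι
      refine ⟨Quotient.mk _ ⟨i, Sphere.base (d i)⟩, ?_⟩
      rw [hqY x hx, wedgeToProd_mk]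
      exact Function.update_eq_self _ _
    · obtain ⟨i, hi⟩ := hpos x hx
      exact ⟨Quotient.mk _ ⟨i, q i x⟩, (hqpos x i hi).symm⟩
  choose f hf using hf
  have hcont : Continuous f := by
    rw [(isEmbedding_wedgeToProd d).continuous_iff]
    exact continuous_pi fun i => by simpa [Function.comp_def, hf] using hq i
  have hfsurj : Function.Surjective f := by
    intro w
    induction w using Quotient.ind with | _ w =>
    obtain ⟨i, z⟩ := w
    by_cases hz : z = Sphere.base (d i)
    · refine ⟨y₀, wedgeToProd_injective d ?_⟩
      rw [hf, hqY y₀ y₀.2, wedgeToProd_mk, hz]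
      exact (Function.update_eq_self _ _).symm
    · obtain ⟨x, rfl⟩ := hsurj i z hz
      refine ⟨x, wedgeToProd_injective d ?_⟩
      rw [hf, wedgeToProd_mk]
      exact hqpos x i (lt_of_le_of_ne (minCoord_nonneg _ x.2.1) fun h0 =>
        hz ((hbase i x).2 h0.symm))
  have hfib : ∀ x y, f x = f y ↔ x = y ∨ (x ∈ Y ∧ y ∈ Y) := by
    intro x y
    rw [← (wedgeToProd_injective d).eq_iff, hf, hf]
    constructor
    · intro hxy
      by_cases hx : x ∈ Y
      · refine .inr ⟨hx, fun i => (hbase i y).1 ?_⟩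
        rw [← congrFun hxy i]
        exact (hbase i x).2 (hx i)
      · obtain ⟨i, hi⟩ := hpos x hx
        exact .inl (hinj i x y hi (congrFun hxy i))
    · rintro (rfl | ⟨hx, hy⟩)
      · rfl
      · rw [hqY x hx, hqY y hy]
  -- with this choice of `c` the normalizing factor of `pushOff` does not vanish
  let c : ℝ := 1 / (Fintype.card α + 1)
  have hc : 0 < c := by positivity
  have hcard : Fintype.card α * c < 1 := by
    simp only [c]
    rw [mul_one_div, div_lt_one (by positivity)]
    linarith
  have hmin : ∀ i, Continuous fun x : realize S => minCoord (σ i) x.1 := fun i =>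
    (continuous_minCoord _).comp continuous_subtype_val
  let D : C(unitInterval × realize S, realize S) :=
    ⟨fun p => ⟨pushOff σ c p.1 p.2.1, h.pushOff_mem hc.le hcard p.1.2.2 p.2.2⟩, by
      have h1 : Continuous fun p : unitInterval × realize S => (p.1 : ℝ) :=
        continuous_subtype_val.comp continuous_fst
      have h2 : ∀ i, Continuous fun p : unitInterval × realize S =>
          min (minCoord (σ i) p.2.1) c := fun i =>
        ((hmin i).comp continuous_snd).min continuous_const
      refine Continuous.subtype_mk (continuous_pi fun b => Continuous.div ?_ ?_ fun p =>
        (h.pushOff_denom_pos hc.le hcard p.1.2.2 p.2.2).ne') _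
      · refine ((continuous_apply b).comp (continuous_subtype_val.comp continuous_snd)).sub
          (h1.mul (continuous_finsetSum _ fun i _ => ?_))
        split_ifs
        · exact h2 i
        · exact continuous_const
      · exact continuous_const.sub (h1.mul (continuous_finsetSum _ fun i _ =>
          continuous_const.mul (h2 i)))⟩
  -- at most one summand is nonzero; the sum vanishes exactly on `Y`
  let m : C(realize S, ℝ) :=
    ⟨fun x => ∑ i, minCoord (σ i) x.1, continuous_finsetSum _ fun i _ => hmin i⟩
  refine nonempty_homotopyEquiv_quotient hcont hfsurj hfib D (fun x => ?_) (fun t y hy => ?_) m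
    (fun y hy => Finset.sum_eq_zero fun i _ => hy i) hc fun x hx => ?_
  · exact Subtype.ext (pushOff_zero σ c x.1)
  · exact Subtype.ext (pushOff_eq_self hc.le t hy)
  · refine (hYeq _).1 (h.pushOff_one_mem hc.le hcard x.2 fun i => le_trans ?_ hx)
    exact Finset.single_le_sum (f := fun i => minCoord (σ i) x.1)
      (fun i _ => minCoord_nonneg _ x.2.1) (Finset.mem_univ i)

end IsFacetFamily

end FacetFamily

/-! ### The multipath complex of a forest -/

namespace DirQuiver

variable {V E : Type*} {Q : DirQuiver V E}

theorem IsForest.realization_multipathComplex [Fintype E] (hQ : Q.IsForest) :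
    realization Q.multipathComplex = realize (indepSets Q.Conflict Finset.univ) := by
  ext x
  refine and_congr Iff.rfl ⟨?_, ?_⟩
  · rintro ⟨σ, hσ, h0, h1⟩
    exact ⟨σ, ⟨Finset.subset_univ _, hQ.isMultipath_iff.1 hσ.2⟩, h0, h1⟩
  · rintro ⟨σ, hσ, h0, h1⟩
    refine ⟨σ, ⟨?_, hQ.isMultipath_iff.2 hσ.2⟩, h0, h1⟩
    rw [Finset.nonempty_iff_ne_empty]
    rintro rfl
    simp at h1

/-- If a directed forest has an edge, then its multipath complex is contractible or homotopy
equivalent to a wedge of spheres. -/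
theorem IsForest.contractible_or_wedge [Finite E] (hQ : Q.IsForest) [Nonempty E] :
    ContractibleSpace (realization Q.multipathComplex) ∨
      ∃ (k : ℕ) (d : Fin (k + 1) → ℕ), Nonempty (ContinuousMap.HomotopyEquiv
        (realization Q.multipathComplex) (WedgeOfSpheres d)) := by
  classical
  have := Fintype.ofFinite E
  rw [hQ.realization_multipathComplex]
  let S : Set (Finset E) := indepSets Q.Conflict Finset.univ
  have hS : IsLowerSet S := isLowerSet_indepSets _ _
  obtain ⟨H, hHS, hmax, hcol⟩ := exists_facets_collapsible Q.Conflict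
    (fun _ _ h => h.symm) Finset.univ fun B _ hB => hQ.exists_simplicial hB
  obtain ⟨e⟩ := ‹Nonempty E›
  have hempty : ∅ ∈ S \ H := by
    refine ⟨⟨Finset.empty_subset _, by simp⟩, fun h => ?_⟩
    have : ({e} : Finset E) ∈ S := ⟨Finset.subset_univ _, by simp⟩
    simpa using hmax ∅ h {e} this (Finset.empty_subset _)
  have hlow : IsLowerSet (S \ H) := fun σ ρ hle hσ =>
    ⟨hS hle hσ.1, fun hρ => hσ.2 ((hmax ρ hρ σ hσ.1 hle).symm ▸ hρ)⟩
  have hcontr := hcol.contractibleSpace hlow ⟨∅, hempty⟩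
  rcases H.eq_empty_or_nonempty with rfl | hne
  · left
    rwa [Set.sdiff_empty] at hcontr
  · right
    have : Nonempty H := hne.to_subtype
    obtain ⟨n, ⟨φ⟩⟩ := Finite.exists_equiv_fin H
    obtain ⟨k, rfl⟩ : ∃ k, n = k + 1 := by
      refine Nat.exists_eq_succ_of_ne_zero ?_
      rintro rfl
      exact (φ (Classical.arbitrary H)).elim0
    let σ : Fin (k + 1) → Finset E := fun i => (φ.symm i).1
    have hrange : Set.range σ = H := by
      ext ρ
      exact ⟨by rintro ⟨i, rfl⟩; exact (φ.symm i).2, fun h => ⟨φ ⟨ρ, h⟩, by simp [σ]⟩⟩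
    have hσ : IsFacetFamily S σ :=
      { isLowerSet := hS
        injective := Subtype.val_injective.comp φ.symm.injective
        nonempty := fun i => Finset.nonempty_iff_ne_empty.2 fun h =>
          hempty.2 (h ▸ (φ.symm i).2)
        mem := fun i => hHS (φ.symm i).2
        maximal := fun i => hmax _ (φ.symm i).2 }
    have : ContractibleSpace (realize (S \ Set.range σ)) := by rwa [hrange]
    exact ⟨k, _, hσ.nonempty_homotopyEquiv_wedge⟩

end DirQuiver

end Multipath
end

theorem mainTheorem7 {V E : Type*} [Finite V] [Finite E] (Q : Multipath.DirQuiver V E) :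
    (Q.IsTree →
      (∀ M : Multipath.Subquiver Q, Q.IsDynamicalModule M → Q.IsStableRegion M) ∧
      (∀ M : Multipath.Subquiver Q, Q.IsDynamicalModule M → M.underlyingGraph.IsTree) ∧
      Nonempty (ContinuousMap.HomotopyEquiv
        (Multipath.realization Q.multipathComplex)
        (Multipath.realization (Multipath.join
          (fun M : {M : Multipath.Subquiver Q // Q.IsDynamicalModule M} =>
            Multipath.matchingComplex M.1.underlyingGraph))))) ∧
    (Q.IsForest →
      (IsEmpty E → IsEmpty (Multipath.realization Q.multipathComplex)) ∧
      (Nonempty E →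
        ContractibleSpace (Multipath.realization Q.multipathComplex) ∨
        ∃ (k : ℕ) (d : Fin (k + 1) → ℕ), Nonempty (ContinuousMap.HomotopyEquiv
          (Multipath.realization Q.multipathComplex) (Multipath.WedgeOfSpheres d)))) := by
  refine ⟨fun hQ => ?_, fun hQ => ⟨fun hE => ⟨fun x => ?_⟩, fun hE => hQ.contractible_or_wedge⟩⟩
  · have hF : Q.IsForest := hQ.2
    exact ⟨fun M hM => hF.isStableRegion hM, fun M hM => hF.underlyingGraph_isTree hM.1.1,
      ⟨(Multipath.realizationCongr (Equiv.ofBijective _ hF.moduleEdge_bijective)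
        fun σ => hF.mem_multipathComplex_iff).toHomotopyEquiv⟩⟩
  · obtain ⟨-, σ, hσ, -⟩ := x.2
    obtain ⟨e, -⟩ := hσ.1
    exact hE.elim e
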